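/- Let $R$ be a complete local reduced noetherian commutative ring of Krull dimension $1$ with total ring of fractions $K$. An $R$-lattice is a finitely generated torsion free $R$-module (regular elements of $R$ act injectively). Let $A$ be a connected $R$-order, that is, a nonzero $R$-algebra which is an $R$-lattice, has no nonzero nilpotent two-sided ideals, and is not a product of two nonzero rings. Put $KA=K\otimes_R A$ and identify $A$ with its image in $KA$. An overring of $A$ is an $R$-order $A'$ with $A\subsetneq A'\subset KA$. An $A$-lattice is a left $A$-module which is an $R$-lattice, and every $A'$-lattice is regarded as an $A$-lattice by restriction. For $A$-lattices write $N\mid^{\oplus} M$ if $N$ is isomorphic to a direct summand of a finite direct sum $rM$ of copies of $M$. An $A$-lattice $I$ is L-injective if every exact sequence $0\to I\to N\to M\to 0$ of $A$-modules with $M$ an $A$-lattice splits; a lattice is bijective if it is both projective and L-injective. Let $B$ be a nonzero bijective $A$-lattice. Then exactly one of the following holds. 1. $A$ is hereditary (every left ideal is projective), $A\mid^{\oplus}B$, and $M\mid^{\oplus}B$ for every $A$-lattice $M$. 2. There is a unique overring $A'=A^-(B)$ of $A$ such that (a) every $A$-lattice $M$ is isomorphic to $B'\oplus M'$, where $B'\mid^{\oplus}B$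 and $M'$ is an $A'$-lattice, and (b) no nonzero $A'$-lattice $N$ satisfies $N\mid^{\oplus}B$ as an $A$-lattice. Moreover, this $A'$ contains every overring of $A$ that satisfies (a). If $B$ is indecomposable, then $A'$ is the only overring of $A$ that satisfies (a), and $A'$ is a minimal overring of $A$ (no overring of $A$ is properly contained in $A'$). -/

import Mathlib

open scoped TensorProduct nonZeroDivisors

universe u

/-- The standing assumptions on the base ring: a complete local reduced noetherian (commutative)
ring of Krull dimension `1`. -/
structure IsBaseRing (R : Type u) [CommRing R] : Prop where
  isLocalRing : IsLocalRing R
  isNoetherianRing : IsNoetherianRing R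
  isReduced : IsReduced R
  ringKrullDim_eq_one : ringKrullDim R = 1
  isAdicComplete : IsAdicComplete (IsLocalRing.maximalIdeal R) R

/-- An `R`-lattice: a finitely generated torsion free `R`-module
(regular elements of `R` act injectively, i.e. `M → K ⊗ M` is injective). -/
structure IsLattice (R M : Type u) [CommRing R] [AddCommGroup M] [Module R M] : Prop where
  finite : Module.Finite R M
  isTorsionFree : Module.IsTorsionFree R M

/-- A ring is semiprime if it has no nonzero nilpotent two-sided ideals. -/
def HasNoNilpotentIdeals (A : Type u) [Ring A] : Prop :=
  ∀ I : Ideal A, I.IsTwoSided → IsNilpotent I → I = ⊥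

/-- An `R`-order: a semiprime `R`-algebra which is an `R`-lattice. -/
structure IsROrder (R A : Type u) [CommRing R] [Ring A] [Algebra R A] : Prop where
  isLattice : IsLattice R A
  semiprime : HasNoNilpotentIdeals A

/-- A ring is connected if it is nonzero and is not a product of two nonzero rings, i.e. its only
central idempotents are `0` and `1`. -/
def IsConnectedRing (A : Type u) [Ring A] : Prop :=
  Nontrivial A ∧ ∀ e : A, IsIdempotentElem e → e ∈ Subring.center A → e = 0 ∨ e = 1

/-- A ring is hereditary if its (left) ideals are projective. For two-sided noetherian rings, such
as `R`-orders, this condition is left-right symmetric. -/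
def IsHereditaryRing (A : Type u) [Ring A] : Prop :=
  ∀ I : Ideal A, Module.Projective A I

/-- An `A`-lattice `I` is L-injective if every exact sequence `0 → I → N → M → 0` of `A`-modules
with `M` an `A`-lattice splits. -/
def IsLInjective (R A I : Type u) [CommRing R] [Ring A] [Algebra R A]
    [AddCommGroup I] [Module A I] : Prop :=
  ∀ (N M : Type u) [AddCommGroup N] [Module A N]
    [AddCommGroup M] [Module R M] [Module A M] [IsScalarTower R A M]
    (f : I →ₗ[A] N) (g : N →ₗ[A] M),
    Function.Injective f → Function.Exact f g → Function.Surjective g → IsLattice R M →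
    ∃ r : N →ₗ[A] I, r ∘ₗ f = LinearMap.id

/-- A bijective `A`-lattice: an `A`-lattice which is both projective and L-injective. -/
structure IsBijectiveLattice (R A B : Type u) [CommRing R] [Ring A] [Algebra R A]
    [AddCommGroup B] [Module R B] [Module A B] [IsScalarTower R A B] : Prop where
  isLattice : IsLattice R B
  projective : Module.Projective A B
  isLInjective : IsLInjective R A B

/-- `N` is a direct summand of a multiple of `M`: for some `r` there are maps `N → rM → N` whose
composition is the identity. -/
def IsSummandOfMultiple (A N M : Type u) [Ring A] [AddCommGroup N] [Module A N]
    [AddCommGroup M] [Module A M] : Prop :=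
  ∃ (r : ℕ) (i : N →ₗ[A] (Fin r → M)) (p : (Fin r → M) →ₗ[A] N), p ∘ₗ i = LinearMap.id

/-- A nonzero module which is not the direct sum of two nonzero submodules. -/
def IsIndecomposableModule (A M : Type u) [Ring A] [AddCommGroup M] [Module A M] : Prop :=
  Nontrivial M ∧ ∀ P Q : Submodule A M, IsCompl P Q → P = ⊥ ∨ Q = ⊥

/-- `KA = K ⊗ A`, where `K` is the total ring of fractions of `R`. -/
abbrev KAlg (R A : Type u) [CommRing R] [Ring A] [Algebra R A] : Type u :=
  FractionRing R ⊗[R] A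

/-- The natural map `A → KA`, `a ↦ 1 ⊗ a` (injective if `A` is torsion free). -/
abbrev toKAlg (R A : Type u) [CommRing R] [Ring A] [Algebra R A] : A →ₐ[R] KAlg R A :=
  Algebra.TensorProduct.includeRight

/-- An overring of `A`: an `R`-order `A'` with `A ⊂ A' ⊂ KA`, the first inclusion being proper. -/
structure IsOverring (R A : Type u) [CommRing R] [Ring A] [Algebra R A]
    (A' : Subalgebra R (KAlg R A)) : Prop where
  lt : (toKAlg R A).range < A'
  isROrder : IsROrder R A'

/-- The `A`-module `M` is (the restriction along `A → A'` of) an `A'`-module. If `M` is an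
`A`-lattice, this says that `M` is an `A'`-lattice, and the `A'`-module structure is then unique. -/
def IsModuleOver (R A M : Type u) [CommRing R] [Ring A] [Algebra R A]
    [AddCommGroup M] [Module A M] (A' : Subalgebra R (KAlg R A)) : Prop :=
  ∃ _ : Module A' M, ∀ (a : A) (x : A') (m : M), (x : KAlg R A) = toKAlg R A a → x • m = a • m

/-- Every `A`-lattice is a direct sum `B' ⊕ M'`, where `B'` is a direct summand of a multiple of `B`
and `M'` is an `A'`-lattice. -/
def LatticesDecompose (R A B : Type u) [CommRing R] [Ring A] [Algebra R A]
    [AddCommGroup B] [Module A B] (A' : Subalgebra R (KAlg R A)) : Prop :=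
  ∀ (M : Type u) [AddCommGroup M] [Module R M] [Module A M] [IsScalarTower R A M],
    IsLattice R M → ∃ B' M' : Submodule A M, IsCompl B' M' ∧
      IsSummandOfMultiple A B' B ∧ IsModuleOver R A M' A'

/-- No nonzero `A'`-lattice is, as an `A`-lattice, a direct summand of a multiple of `B`. -/
def RejectsSummands (R A B : Type u) [CommRing R] [Ring A] [Algebra R A]
    [AddCommGroup B] [Module A B] (A' : Subalgebra R (KAlg R A)) : Prop :=
  ∀ (M : Type u) [AddCommGroup M] [Module R M] [Module A M] [IsScalarTower R A M],
    IsLattice R M → IsModuleOver R A M A' → IsSummandOfMultiple A M B → Subsingleton M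

/-!
Call a lattice *`B`-free* if it has no nonzero direct summand in the additive closure of `B`. Every
lattice is the sum of a lattice in the additive closure of `B` and a `B`-free one. The ring `A⁻(B)`
is therefore defined as the set `rejectionRing` of all elements of `KA` that map every `B`-free
lattice into itself, and the decomposition of lattices over it holds by construction. Elements of
`KA` act on lattices through the relation `FracAct`, which clears denominators.

The heart of the matter is that `A⁻(B)` rejects `B`
(`subsingleton_of_rejectionRing_stabilizes`). Let `N` be an indecomposable summand of a multiple
of `B` and `N'` a minimal overlattice of `N`. A map `φ` from `N` to a `B`-free lattice `M` extends
to `N'`: otherwise `N → N' ⊕ M` has a lattice as cokernel, so it splits because `N` is L-injective,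
and as `N` has a local endomorphism ring (completeness of `R`), it would be a summand of `M` or of
`N'`, both impossible. Take `n ∈ N' \ N` and coordinates `g : N → Aᵏ` of the projective module `N`.
The coordinates of `n` in `KA` preserve every `B`-free `M`, because `x ↦ g(x)ⱼ m` extends to `N'`;
they do not all preserve `N`, because they recover `n`.

It remains to know when `A⁻(B)` is an order. If the `B`-free lattices have zero common annihilator
`J` in `A`, one of them is faithful, as `KA` is artinian, and `A⁻(B)` embeds in its endomorphism
ring. If `J ≠ 0`, then `A` modulo the right annihilator of `J` lies in the additive closure of `B`,
so it is projective and the right annihilator is generated by a central idempotent; as `A` is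
connected, it vanishes. Since `KA` is semisimple, `J` then contains a regular element of `R`, so
there are no nonzero `B`-free lattices, all lattices are projective, and `A` is hereditary.

The uniqueness statements are formal: an overring with the decomposition property preserves all
`B`-free lattices, and one with the rejection property is itself a `B`-free lattice.
-/

/-! ### Commutative algebra of the base ring -/

/-- In a reduced noetherian ring the zero divisors are the union of the finitely many minimal primes,
so by prime avoidance a prime consisting of zero divisors is minimal. -/
theorem Ideal.IsPrime.mem_minimalPrimes_of_disjoint {R : Type*} [CommRing R] [IsNoetherianRing R]
    [IsReduced R] {p : Ideal R} (hp : p.IsPrime) (h : Disjoint (p : Set R) (R⁰ : Set R)) :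
    p ∈ minimalPrimes R := by
  have hsub : (p : Set R) ⊆ ⋃ q ∈ minimalPrimes R, (q : Set R) := by
    intro a ha
    have ha' : a ∉ R⁰ := fun h' => Set.disjoint_left.mp h ha h'
    rw [mem_nonZeroDivisors_iff_right] at ha'
    push Not at ha'
    obtain ⟨b, hab, hb⟩ := ha'
    have : b ∉ sInf (minimalPrimes R) := by
      have h0 := Ideal.sInf_minimalPrimes (I := (⊥ : Ideal R))
      rw [minimalPrimes, h0]
      intro h1
      exact hb (IsReduced.eq_zero b (mem_nilradical.mp h1))
    rw [Submodule.mem_sInf] at this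
    push Not at this
    obtain ⟨q, hq, hbq⟩ := this
    have hqp : Ideal.IsPrime q := hq.1.1
    refine Set.mem_biUnion hq ?_
    exact (hqp.mem_or_mem (show b * a ∈ q by rw [hab]; exact q.zero_mem)).resolve_left hbq
  obtain ⟨q, hq, hle⟩ := (Ideal.subset_union_prime_finite
    (minimalPrimes.finite_of_isNoetherianRing R) (f := id) ⊥ ⊥
    (fun i hi _ _ => hi.1.1)).mp (by simpa using hsub)
  have hle : p ≤ q := hle
  have : p = q := le_antisymm hle (hq.2 ⟨hp, bot_le⟩ hle)
  exact this ▸ hq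

theorem IsReduced.isArtinianRing_fractionRing (R : Type*) [CommRing R] [IsNoetherianRing R]
    [IsReduced R] : IsArtinianRing (FractionRing R) := by
  have : IsNoetherianRing (FractionRing R) := IsLocalization.isNoetherianRing R⁰ _ inferInstance
  have : Ring.KrullDimLE 0 (FractionRing R) := by
    rw [Ring.krullDimLE_zero_iff]
    intro q hq
    obtain ⟨q', hq', hle⟩ := q.exists_le_maximal hq.ne_top
    have key : ∀ I : Ideal (FractionRing R), I.IsPrime →
        I.comap (algebraMap R (FractionRing R)) ∈ minimalPrimes R := fun I hI =>
      (hI.comap _).mem_minimalPrimes_of_disjoint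
        ((IsLocalization.isPrime_iff_isPrime_disjoint R⁰ _ I).mp hI).2.symm
    have h1 := key q hq
    have h2 := key q' hq'.isPrime
    have h3 : q'.comap (algebraMap R (FractionRing R)) ≤ q.comap (algebraMap R (FractionRing R)) :=
      h2.2 h1.1 (Ideal.comap_mono hle)
    have : q' ≤ q := by
      rw [← IsLocalization.map_under R⁰ _ q', ← IsLocalization.map_under R⁰ _ q]
      exact Ideal.map_mono h3
    rwa [le_antisymm hle this]
  exact IsNoetherianRing.isArtinianRing_of_krullDimLE_zero

theorem IsBaseRing.exists_regular_mem_maximalIdeal {R : Type u} [CommRing R] (hR : IsBaseRing R)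
    [IsLocalRing R] : ∃ r ∈ IsLocalRing.maximalIdeal R, r ∈ R⁰ := by
  by_contra! hcon
  have := hR.isNoetherianRing
  have := hR.isReduced
  have hmin := (IsLocalRing.maximalIdeal.isMaximal R).isPrime.mem_minimalPrimes_of_disjoint
    (Set.disjoint_left.mpr hcon)
  have : Ring.KrullDimLE 0 R := by
    rw [Ring.krullDimLE_zero_iff]
    intro q hq
    have hle := IsLocalRing.le_maximalIdeal hq.ne_top
    rw [le_antisymm hle (hmin.2 ⟨hq, bot_le⟩ hle)]
    exact IsLocalRing.maximalIdeal.isMaximal R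
  have h0 := (ringKrullDimZero_iff_ringKrullDim_eq_zero (R := R)).mp this
  rw [hR.ringKrullDim_eq_one] at h0
  exact one_ne_zero h0

theorem IsBaseRing.isArtinianRing_quotient {R : Type u} [CommRing R] (hR : IsBaseRing R)
    {r : R} (hr : r ∈ R⁰) : IsArtinianRing (R ⧸ Ideal.span {r}) := by
  have := hR.isNoetherianRing
  have h := ringKrullDim_quotient_succ_le_of_nonZeroDivisor hr
  rw [hR.ringKrullDim_eq_one] at h
  have : Ring.KrullDimLE 0 (R ⧸ Ideal.span {r}) := by
    rw [Ring.KrullDimLE, Order.krullDimLE_iff]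
    change ringKrullDim _ ≤ _
    generalize ringKrullDim (R ⧸ Ideal.span {r}) = d at h
    induction d with
    | bot => exact bot_le
    | coe d =>
      have h' : d + 1 ≤ 0 + 1 := by exact_mod_cast h
      exact_mod_cast (ENat.add_le_add_iff_right ENat.one_ne_top).mp h'
  exact IsNoetherianRing.isArtinianRing_of_krullDimLE_zero

/-- Adic Cauchy sequences converge in finitely generated modules over a complete noetherian ring. -/
theorem IsAdicComplete.isPrecomplete_of_finite {R : Type*} [CommRing R] [IsNoetherianRing R]
    (I : Ideal R) [IsAdicComplete I R] (M : Type*) [AddCommGroup M] [Module R M]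
    [Module.Finite R M] : IsPrecomplete I M := by
  rw [← AdicCompletion.of_surjective_iff]
  intro x
  obtain ⟨t, rfl⟩ := AdicCompletion.ofTensorProduct_surjective_of_finite I M x
  induction t with
  | zero => exact ⟨0, by simp⟩
  | add s t hs ht =>
    obtain ⟨a, ha⟩ := hs
    obtain ⟨b, hb⟩ := ht
    exact ⟨a + b, by rw [map_add, map_add, ha, hb]⟩
  | tmul a m =>
    obtain ⟨r, rfl⟩ := (AdicCompletion.of_bijective_iff (I := I) (M := R)).mpr inferInstance |>.2 a
    refine ⟨r • m, ?_⟩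
    rw [AdicCompletion.ofTensorProduct_tmul, map_smul]
    ext n
    rw [AdicCompletion.smul_eval]
    change _ = Ideal.Quotient.mk (I ^ n • ⊤ : Ideal R) r • Submodule.Quotient.mk m
    rw [AdicCompletion.val_smul_apply]
    rfl

theorem HenselianRing.of_finite {R S : Type*} [CommRing R] [IsNoetherianRing R] [IsLocalRing R]
    [IsAdicComplete (IsLocalRing.maximalIdeal R) R] [CommRing S] [Algebra R S]
    [Module.Finite R S] :
    HenselianRing S ((IsLocalRing.maximalIdeal R).map (algebraMap R S)) := by
  have h1 : IsHausdorff (IsLocalRing.maximalIdeal R) S := inferInstance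
  have h2 := IsAdicComplete.isPrecomplete_of_finite (IsLocalRing.maximalIdeal R) S
  have : IsAdicComplete ((IsLocalRing.maximalIdeal R).map (algebraMap R S)) S :=
    { toIsHausdorff := IsHausdorff.map_algebraMap_iff.mpr h1
      toIsPrecomplete := IsPrecomplete.map_algebraMap_iff.mpr h2 }
  infer_instance



/-- Modulo the maximal ideal of `R`, an element `v` of `S` lives in an artinian ring, where an
idempotent separates the part on which `v` is invertible from the part on which `v` is nilpotent.
The idempotent lifts to `S`. The two units say that `v ^ (n + 1)` is close to zero where `e = 0` and
that `v` is invertible where `e = 1`. -/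
theorem exists_isIdempotentElem_fitting {R S : Type*} [CommRing R] [IsNoetherianRing R]
    [IsLocalRing R] [IsAdicComplete (IsLocalRing.maximalIdeal R) R] [CommRing S] [Algebra R S]
    [Module.Finite R S] (v : S) :
    ∃ (e w : S) (n : ℕ), IsIdempotentElem e ∧ IsUnit (1 - v ^ (n + 1) + v ^ (n + 1) * e) ∧
      IsUnit (1 - e + v ^ (n + 1) * w) := by
  let I := (IsLocalRing.maximalIdeal R).map (algebraMap R S)
  have hH : HenselianRing S I := HenselianRing.of_finite
  have hjac : ∀ x ∈ I, IsUnit (1 + x) := fun x hx => by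
    have := Ideal.mem_jacobson_bot.mp (hH.jac hx) 1
    rwa [mul_one, add_comm] at this
  have hart : IsArtinianRing (S ⧸ I) := by
    have : IsArtinianRing (R ⧸ IsLocalRing.maximalIdeal R) :=
      inferInstanceAs (IsArtinianRing (IsLocalRing.ResidueField R))
    have : Module.Finite (R ⧸ IsLocalRing.maximalIdeal R) (S ⧸ I) :=
      Module.Finite.of_restrictScalars_finite R _ _
    exact isArtinian_of_tower (R ⧸ IsLocalRing.maximalIdeal R) inferInstance
  obtain ⟨n, z, hn⟩ : ∃ (n : ℕ) (z : S), v ^ (n + 1) * (v ^ (n + 1) * z) - v ^ (n + 1) ∈ I := by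
    obtain ⟨n, y, hy⟩ := IsArtinian.exists_pow_succ_smul_dvd (Ideal.Quotient.mk I v) (1 : S ⧸ I)
    obtain ⟨y, rfl⟩ := Ideal.Quotient.mk_surjective y
    refine ⟨n, y ^ (n + 1), ?_⟩
    rw [← Ideal.Quotient.eq, ← mul_pow]
    simp only [map_mul, map_pow, smul_eq_mul, mul_one] at hy ⊢
    generalize Ideal.Quotient.mk I v = a at *
    generalize Ideal.Quotient.mk I y = b at *
    have h1 : a ^ (n + 1) * (a * b) = a ^ (n + 1) := by
      rw [Nat.succ_eq_add_one] at hy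
      linear_combination a * hy
    have h2 : ∀ k : ℕ, a ^ (n + 1) * (a * b) ^ k = a ^ (n + 1) := by
      intro k
      induction k with
      | zero => simp
      | succ k ih => rw [pow_succ (a * b), ← mul_assoc, ih, h1]
    exact h2 _
  obtain ⟨e, he, hez⟩ := hH.is_henselian (Polynomial.X ^ 2 - Polynomial.X)
    (by monicity!) (v ^ (n + 1) * z)
    (by
      simp only [Polynomial.eval_sub, Polynomial.eval_pow, Polynomial.eval_X]
      convert! I.mul_mem_right z hn using 1
      ring)
    (by
      refine IsUnit.of_mul_eq_one (Ideal.Quotient.mk I (2 * (v ^ (n + 1) * z) - 1)) ?_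
      rw [← map_mul, ← map_one (Ideal.Quotient.mk I), Ideal.Quotient.eq]
      simp only [Polynomial.derivative_sub, Polynomial.derivative_X_pow, Polynomial.derivative_X,
        Polynomial.eval_sub, Polynomial.eval_mul, Polynomial.eval_pow, Polynomial.eval_X,
        Polynomial.eval_one, Polynomial.eval_C]
      convert! I.mul_mem_right (4 * z) hn using 1
      push_cast
      ring)
  refine ⟨e, z, n, ?_, ?_, ?_⟩
  · simp only [Polynomial.IsRoot.def, Polynomial.eval_sub, Polynomial.eval_pow,
      Polynomial.eval_X] at he
    rw [IsIdempotentElem]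
    linear_combination he
  · convert! hjac _ (I.add_mem hn (I.mul_mem_left (v ^ (n + 1)) hez)) using 1
    ring
  · convert! hjac _ (I.neg_mem hez) using 1
    ring

/-- Fitting's dichotomy for one element of a finite algebra over a complete local ring: if the only
idempotents are trivial, then the element or its complement is invertible. -/
theorem isUnit_or_isUnit_one_sub_of_idempotents_trivial {R E : Type*} [CommRing R]
    [IsNoetherianRing R] [IsLocalRing R] [IsAdicComplete (IsLocalRing.maximalIdeal R) R]
    [Ring E] [Algebra R E] [Module.Finite R E]
    (hE : ∀ e : E, IsIdempotentElem e → e = 0 ∨ e = 1) (u : E) : IsUnit u ∨ IsUnit (1 - u) := by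
  have : IsMulCommutative (Algebra.adjoin R {u}) := Algebra.isMulCommutative_adjoin R (by simp)
  have : Module.Finite R (Algebra.adjoin R {u}) :=
    Module.Finite.of_injective (Algebra.adjoin R {u}).val.toLinearMap Subtype.val_injective
  let φ : Algebra.adjoin R {u} →ₐ[R] E := (Algebra.adjoin R {u}).val
  let v : Algebra.adjoin R {u} := ⟨u, Algebra.subset_adjoin rfl⟩
  have hφ : φ v = u := rfl
  obtain ⟨e, w, n, he, h0, h1⟩ := exists_isIdempotentElem_fitting (R := R) v
  rcases hE _ (he.map φ) with h | h
  · right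
    have := h0.map φ
    simp only [map_add, map_sub, map_mul, map_pow, map_one, h, hφ, mul_zero, add_zero] at this
    have hc : Commute (1 - u) (∑ i ∈ Finset.range (n + 1), u ^ i) := by
      refine Commute.sum_right _ _ _ fun i _ => ?_
      exact (Commute.one_left _).sub_left ((Commute.refl u).pow_right i)
    rw [← mul_neg_geom_sum] at this
    exact (hc.isUnit_mul_iff.mp this).1
  · left
    have := h1.map φ
    simp only [map_add, map_sub, map_mul, map_pow, map_one, h, hφ, sub_self, zero_add,
      pow_succ', mul_assoc] at this
    have hc : Commute u (u ^ n * φ w) := by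
      refine ((Commute.refl u).pow_right n).mul_right ?_
      exact (Commute.all v w).map φ
    exact (hc.isUnit_mul_iff.mp this).1

/-! ### Lattices and their direct summands -/

/-- An `A`-linear map between compatible `R`-modules, regarded as an `R`-linear map. -/
abbrev LinearMap.toBase (R : Type u) [CommRing R] {A : Type u} [Ring A] [Algebra R A]
    {M N : Type u} [AddCommGroup M] [Module R M] [Module A M] [IsScalarTower R A M]
    [AddCommGroup N] [Module R N] [Module A N] [IsScalarTower R A N] (f : M →ₗ[A] N) :
    M →ₗ[R] N := f.restrictScalars R

namespace IsLattice

variable {R : Type u} [CommRing R]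

theorem regular_smul_cancel {M : Type u} [AddCommGroup M] [Module R M] (h : IsLattice R M) {s : R}
    (hs : s ∈ R⁰) {m m' : M} (hm : s • m = s • m') : m = m' :=
  have := h.isTorsionFree
  have hs' : IsRegular s := isRegular_iff_mem_nonZeroDivisors.mpr hs
  hs'.smul_right_injective M hm

theorem of_smul_eq_zero {M : Type u} [AddCommGroup M] [Module R M] [Module.Finite R M]
    (h : ∀ s ∈ R⁰, ∀ m : M, s • m = 0 → m = 0) : IsLattice R M where
  finite := inferInstance
  isTorsionFree := ⟨fun s hs m m' hm => by
    rw [← sub_eq_zero]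
    refine h s (isRegular_iff_mem_nonZeroDivisors.mp hs) _ ?_
    rw [smul_sub, sub_eq_zero]
    exact hm⟩

theorem of_injective [IsNoetherianRing R] {M N : Type u} [AddCommGroup M] [Module R M]
    [AddCommGroup N] [Module R N] (hN : IsLattice R N) (f : M →ₗ[R] N)
    (hf : Function.Injective f) : IsLattice R M := by
  have := hN.finite
  have : Module.Finite R M := Module.Finite.of_injective f hf
  refine of_smul_eq_zero fun s hs m hm => hf (hN.regular_smul_cancel hs ?_)
  rw [← map_smul, hm, map_zero, smul_zero]

theorem prod {M N : Type u} [AddCommGroup M] [Module R M] [AddCommGroup N] [Module R N]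
    (hM : IsLattice R M) (hN : IsLattice R N) : IsLattice R (M × N) := by
  have := hM.finite
  have := hN.finite
  refine of_smul_eq_zero fun s hs m hm => Prod.ext ?_ ?_
  · refine hM.regular_smul_cancel hs ?_
    simpa using congrArg Prod.fst hm
  · refine hN.regular_smul_cancel hs ?_
    simpa using congrArg Prod.snd hm

theorem pi {M : Type u} [AddCommGroup M] [Module R M] (hM : IsLattice R M) (r : ℕ) :
    IsLattice R (Fin r → M) := by
  have := hM.finite
  refine of_smul_eq_zero fun s hs m hm => funext fun j => hM.regular_smul_cancel hs ?_
  simpa using congrFun hm j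

variable {A : Type u} [Ring A] [Algebra R A]

variable {M : Type u} [AddCommGroup M] [Module R M] [Module A M] [IsScalarTower R A M]
variable {N : Type u} [AddCommGroup N] [Module R N] [Module A N] [IsScalarTower R A N]

theorem submodule [IsNoetherianRing R] (hM : IsLattice R M) (P : Submodule A M) :
    IsLattice R P :=
  hM.of_injective (P.subtype.toBase R) P.injective_subtype

theorem isNoetherian [IsNoetherianRing R] (hM : IsLattice R M) : IsNoetherian A M :=
  have := hM.finite
  isNoetherian_of_tower R inferInstance

end IsLattice

section Retracts

variable {A : Type u} [Ring A]
variable {M N X Y : Type u} [AddCommGroup M] [Module A M] [AddCommGroup N] [Module A N]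
  [AddCommGroup X] [Module A X] [AddCommGroup Y] [Module A Y]

namespace IsSummandOfMultiple

theorem of_retract (h : IsSummandOfMultiple A N M) (i : X →ₗ[A] N) (p : N →ₗ[A] X)
    (hpi : p ∘ₗ i = LinearMap.id) : IsSummandOfMultiple A X M := by
  obtain ⟨r, j, q, hqj⟩ := h
  refine ⟨r, j ∘ₗ i, p ∘ₗ q, ?_⟩
  rw [LinearMap.comp_assoc, ← LinearMap.comp_assoc i, hqj, LinearMap.id_comp, hpi]

theorem prod (hN : IsSummandOfMultiple A N M) (hX : IsSummandOfMultiple A X M) :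
    IsSummandOfMultiple A (N × X) M := by
  obtain ⟨r, i, p, h⟩ := hN
  obtain ⟨s, j, q, h'⟩ := hX
  let e : (Fin (r + s) → M) ≃ₗ[A] (Fin r → M) × (Fin s → M) :=
    (LinearEquiv.funCongrLeft A M finSumFinEquiv).trans (LinearEquiv.sumArrowLequivProdArrow _ _ A M)
  refine ⟨r + s, e.symm.toLinearMap ∘ₗ i.prodMap j, p.prodMap q ∘ₗ e.toLinearMap, ?_⟩
  ext x <;> simp
  · exact LinearMap.congr_fun h x
  · exact LinearMap.congr_fun h' x

theorem refl (M : Type u) [AddCommGroup M] [Module A M] : IsSummandOfMultiple A M M :=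
  ⟨1, LinearMap.pi fun _ => LinearMap.id, LinearMap.proj 0, rfl⟩

theorem trans (hX : IsSummandOfMultiple A X N) (hN : IsSummandOfMultiple A N M) :
    IsSummandOfMultiple A X M := by
  obtain ⟨r, i, p, h⟩ := hX
  refine of_retract (N := Fin r → N) ?_ i p h
  clear h i p
  induction r with
  | zero => exact ⟨0, 0, 0, LinearMap.ext fun x => Subsingleton.elim _ _⟩
  | succ r ih =>
    refine (hN.prod ih).of_retract (Fin.consLinearEquiv A (fun _ => N)).symm.toLinearMap
      (Fin.consLinearEquiv A (fun _ => N)).toLinearMap ?_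
    ext x
    simp

theorem isLattice {R : Type u} [CommRing R] [IsNoetherianRing R] [Algebra R A]
    [Module R M] [IsScalarTower R A M] [Module R N] [IsScalarTower R A N]
    (h : IsSummandOfMultiple A N M) (hM : IsLattice R M) : IsLattice R N := by
  obtain ⟨r, i, p, h⟩ := h
  exact (hM.pi r).of_injective (i.toBase R)
    (LinearMap.injective_of_comp_eq_id i p h)

theorem projective (h : IsSummandOfMultiple A N M) [Module.Projective A M] :
    Module.Projective A N := by
  obtain ⟨r, i, p, h⟩ := h
  have : Module.Projective A (Fin r → M) :=
    Module.Projective.of_equiv (DFinsupp.linearEquivFunOnFintype (R := A) (M := fun _ : Fin r => M))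
  exact Module.Projective.of_split i p h

end IsSummandOfMultiple

/-- The projection onto a direct summand, as a retraction of the inclusion. -/
theorem Submodule.exists_retraction {P Q : Submodule A M} (h : IsCompl P Q) :
    ∃ p : M →ₗ[A] P, p ∘ₗ P.subtype = LinearMap.id :=
  ⟨P.projectionOnto Q h, LinearMap.ext fun x => Submodule.projectionOnto_apply_left h x⟩

theorem LinearMap.isCompl_range_ker_of_comp_eq_id {i : X →ₗ[A] M} {p : M →ₗ[A] X}
    (h : p ∘ₗ i = LinearMap.id) : IsCompl (LinearMap.range i) (LinearMap.ker p) := by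
  have h' : ∀ x, p (i x) = x := LinearMap.congr_fun h
  refine ⟨Submodule.disjoint_def.mpr ?_, codisjoint_iff.mpr (eq_top_iff.mpr fun m _ => ?_)⟩
  · rintro _ ⟨x, rfl⟩ hx
    rw [LinearMap.mem_ker, h'] at hx
    rw [hx, map_zero]
  · refine Submodule.mem_sup.mpr ⟨i (p m), ⟨_, rfl⟩, m - i (p m), ?_, add_sub_cancel _ _⟩
    rw [LinearMap.mem_ker, map_sub, h', sub_self]

/-- The module `M` has no nonzero direct summand in the additive closure of `B`, that is, among the
direct summands of multiples of `B`. -/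
def HasNoSummandIn (A B M : Type u) [Ring A] [AddCommGroup B] [Module A B]
    [AddCommGroup M] [Module A M] : Prop :=
  ∀ P Q : Submodule A M, IsCompl P Q → IsSummandOfMultiple A P B → P = ⊥

variable {B : Type u} [AddCommGroup B] [Module A B]

theorem HasNoSummandIn.subsingleton_of_retract (h : HasNoSummandIn A B M)
    (hX : IsSummandOfMultiple A X B) (i : X →ₗ[A] M) (p : M →ₗ[A] X)
    (hpi : p ∘ₗ i = LinearMap.id) : Subsingleton X := by
  have hi : Function.Injective i := LinearMap.injective_of_comp_eq_id i p hpi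
  let e := LinearEquiv.ofInjective i hi
  have := h (LinearMap.range i) (LinearMap.ker p) (LinearMap.isCompl_range_ker_of_comp_eq_id hpi)
    (hX.of_retract e.symm.toLinearMap e.toLinearMap (by ext x; simp))
  have : Subsingleton (LinearMap.range i) := by rw [this]; infer_instance
  exact e.toEquiv.subsingleton

theorem IsIndecomposableModule.eq_zero_or_one (h : IsIndecomposableModule A N)
    (e : Module.End A N) (he : IsIdempotentElem e) : e = 0 ∨ e = 1 := by
  have hc : IsCompl (LinearMap.range e) (LinearMap.ker e) := LinearMap.IsIdempotentElem.isCompl he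
  rcases h.2 _ _ hc with h | h
  · exact Or.inl (LinearMap.range_eq_bot.mp h)
  · right
    have hinj := LinearMap.ker_eq_bot.mp h
    ext x
    exact hinj (LinearMap.congr_fun he x)

theorem Submodule.map_subtype_eq_bot {P : Submodule A M} {X : Submodule A P}
    (h : X.map P.subtype = ⊥) : X = ⊥ :=
  Submodule.map_injective_of_injective P.injective_subtype (h.trans (Submodule.map_bot _).symm)

theorem IsSummandOfMultiple.sup {P Q : Submodule A M} (hP : IsSummandOfMultiple A P N)
    (hQ : IsSummandOfMultiple A Q N) (h : Disjoint P Q) :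
    IsSummandOfMultiple A ↥(P ⊔ Q) N := by
  have hinj : Function.Injective (P.subtype.coprod Q.subtype) := by
    rw [← LinearMap.ker_eq_bot, LinearMap.ker_coprod_of_disjoint_range _ _ (by simpa using h)]
    simp
  let e := (LinearEquiv.ofInjective _ hinj).trans
    (LinearEquiv.ofEq _ (P ⊔ Q) (by rw [LinearMap.range_coprod]; simp))
  exact (hP.prod hQ).of_retract e.symm.toLinearMap e.toLinearMap
    (LinearMap.ext fun x => e.apply_symm_apply x)

/-- A nonzero noetherian module has an indecomposable direct summand. -/
theorem exists_indecomposable_retract [IsNoetherian A M] [Nontrivial M] :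
    ∃ (P Q : Submodule A M), IsCompl P Q ∧ IsIndecomposableModule A P := by
  obtain ⟨Q, ⟨hQ, P, hPQ⟩, hmax⟩ := set_has_maximal_iff_noetherian.mpr ‹IsNoetherian A M›
    {Q | Q ≠ ⊤ ∧ ∃ P, IsCompl P Q} ⟨⊥, bot_ne_top, ⊤, isCompl_top_bot⟩
  refine ⟨P, Q, hPQ, ?_, fun X Y hXY => ?_⟩
  · rw [Submodule.nontrivial_iff_ne_bot]
    rintro rfl
    exact hQ (by simpa using hPQ.codisjoint.eq_top)
  · by_contra! hcon
    have hdisj : Disjoint (X.map P.subtype) (Y.map P.subtype) :=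
      Submodule.disjoint_map P.injective_subtype hXY.disjoint
    have hsup : X.map P.subtype ⊔ Y.map P.subtype = P := by
      rw [← Submodule.map_sup, hXY.sup_eq_top, Submodule.map_subtype_top]
    have h1 : IsCompl (Y.map P.subtype) (X.map P.subtype ⊔ Q) :=
      hdisj.symm.isCompl_sup_right_of_isCompl_sup_left (by rwa [sup_comm, hsup])
    refine hmax (X.map P.subtype ⊔ Q) ⟨fun h => ?_, _, h1⟩ ?_
    · rw [h] at h1
      have := eq_bot_of_isCompl_top h1
      exact hcon.2 (Submodule.map_subtype_eq_bot this)
    · refine lt_of_le_of_ne le_sup_right fun h => ?_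
      have hle : X.map P.subtype ≤ Q := h ▸ le_sup_left
      have := hPQ.disjoint (Submodule.map_subtype_le P X) hle
      exact hcon.1 (Submodule.map_subtype_eq_bot
        (le_bot_iff.mp this))

/-- Every noetherian module splits off a largest direct summand in the additive closure of `B`. -/
theorem exists_isCompl_hasNoSummandIn [IsNoetherian A M] :
    ∃ P Q : Submodule A M, IsCompl P Q ∧ IsSummandOfMultiple A P B ∧ HasNoSummandIn A B Q := by
  obtain ⟨P, ⟨hP, Q, hPQ⟩, hmax⟩ := set_has_maximal_iff_noetherian.mpr ‹IsNoetherian A M›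
    {P | IsSummandOfMultiple A P B ∧ ∃ Q, IsCompl P Q}
    ⟨⊥, ⟨0, 0, 0, LinearMap.ext fun x => Subsingleton.elim _ _⟩, ⊤, isCompl_bot_top⟩
  refine ⟨P, Q, hPQ, hP, fun X Y hXY hX => ?_⟩
  have hdisj : Disjoint (X.map Q.subtype) (Y.map Q.subtype) :=
    Submodule.disjoint_map Q.injective_subtype hXY.disjoint
  have hsup : X.map Q.subtype ⊔ Y.map Q.subtype = Q := by
    rw [← Submodule.map_sup, hXY.sup_eq_top, Submodule.map_subtype_top]
  have h1 : IsCompl (P ⊔ X.map Q.subtype) (Y.map Q.subtype) :=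
    hdisj.isCompl_sup_left_of_isCompl_sup_right (by rwa [hsup])
  have hPX : Disjoint P (X.map Q.subtype) :=
    hPQ.disjoint.mono_right (Submodule.map_subtype_le Q X)
  have hX' : IsSummandOfMultiple A (X.map Q.subtype) B :=
    hX.of_retract (Submodule.equivMapOfInjective _ Q.injective_subtype X).symm.toLinearMap
      (Submodule.equivMapOfInjective _ Q.injective_subtype X).toLinearMap (by ext x; simp)
  have hsum := hP.sup hX' hPX
  by_contra hne
  refine hmax (P ⊔ X.map Q.subtype) ⟨hsum, _, h1⟩ (lt_of_le_of_ne le_sup_left fun h => hne ?_)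
  have hle : X.map Q.subtype ≤ P := h ▸ le_sup_right
  have := hPX hle le_rfl
  exact Submodule.map_subtype_eq_bot (le_bot_iff.mp this)

/-- The extension property of an L-injective lattice along inclusions with lattice cokernel. -/
theorem IsLInjective.exists_extension {R : Type u} [CommRing R] [Algebra R A] {I : Type u}
    [AddCommGroup I] [Module A I] (hI : IsLInjective R A I)
    [Module R Y] [IsScalarTower R A Y] (f : X →ₗ[A] Y) (hf : Function.Injective f)
    (hY : IsLattice R (Y ⧸ LinearMap.range f)) (h : X →ₗ[A] I) :
    ∃ g : Y →ₗ[A] I, g ∘ₗ f = h := by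
  -- the pushout of `f` along `h`
  let D : Submodule A (I × Y) := LinearMap.range (h.prod (-f))
  let ι : I →ₗ[A] (I × Y) ⧸ D := D.mkQ ∘ₗ LinearMap.inl A I Y
  let π : ((I × Y) ⧸ D) →ₗ[A] Y ⧸ LinearMap.range f :=
    D.liftQ ((LinearMap.range f).mkQ ∘ₗ LinearMap.snd A I Y) (by
      rintro _ ⟨x, rfl⟩
      simp)
  have hι : Function.Injective ι := by
    rw [injective_iff_map_eq_zero]
    intro i hi
    obtain ⟨x, hx⟩ := (Submodule.Quotient.mk_eq_zero D).mp hi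
    have h1 : h x = i := congrArg Prod.fst hx
    have h2 : -f x = 0 := congrArg Prod.snd hx
    have : x = 0 := hf (by rw [map_zero]; exact neg_eq_zero.mp h2)
    rw [← h1, this, map_zero]
  have hex : Function.Exact ι π := by
    intro z
    obtain ⟨⟨i, y⟩, rfl⟩ := D.mkQ_surjective z
    constructor
    · intro hz
      obtain ⟨x, hx⟩ : y ∈ LinearMap.range f := (Submodule.Quotient.mk_eq_zero _).mp hz
      refine ⟨i + h x, ?_⟩
      refine (Submodule.Quotient.eq D).mpr ⟨x, ?_⟩
      simp [← hx]
    · rintro ⟨i', hi'⟩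
      rw [← hi']
      simp [ι, π]
  have hπ : Function.Surjective π := by
    intro z
    obtain ⟨y, rfl⟩ := (LinearMap.range f).mkQ_surjective z
    exact ⟨D.mkQ (0, y), rfl⟩
  obtain ⟨r, hr⟩ := hI _ _ ι π hι hex hπ hY
  refine ⟨r ∘ₗ D.mkQ ∘ₗ LinearMap.inr A I Y, LinearMap.ext fun x => ?_⟩
  have h1 : D.mkQ (0, f x) = D.mkQ (h x, 0) := by
    refine (Submodule.Quotient.eq D).mpr ⟨-x, ?_⟩
    simp
  change r (D.mkQ (0, f x)) = h x
  rw [h1]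
  exact LinearMap.congr_fun hr (h x)

/-- Summands of multiples of an L-injective lattice split off along inclusions with lattice
cokernel. -/
theorem IsLInjective.exists_retraction {R : Type u} [CommRing R] [Algebra R A]
    (hB : IsLInjective R A B) (hX : IsSummandOfMultiple A X B)
    [Module R Y] [IsScalarTower R A Y] (f : X →ₗ[A] Y) (hf : Function.Injective f)
    (hY : IsLattice R (Y ⧸ LinearMap.range f)) :
    ∃ g : Y →ₗ[A] X, g ∘ₗ f = LinearMap.id := by
  obtain ⟨r, i, p, hpi⟩ := hX
  choose g hg using fun j => hB.exists_extension f hf hY (LinearMap.proj j ∘ₗ i)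
  refine ⟨p ∘ₗ LinearMap.pi g, LinearMap.ext fun x => ?_⟩
  rw [← hpi]
  simp only [LinearMap.comp_apply]
  congr 1
  ext j
  exact LinearMap.congr_fun (hg j) x

end Retracts

section LocalEndomorphisms

variable {R A : Type u} [CommRing R] [Ring A] [Algebra R A]
variable {M N X Y : Type u} [AddCommGroup M] [Module R M] [Module A M] [IsScalarTower R A M]
  [AddCommGroup N] [Module R N] [Module A N] [IsScalarTower R A N]
  [AddCommGroup X] [Module A X] [AddCommGroup Y] [Module A Y]

/-- The endomorphism ring of an indecomposable lattice is local. -/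
theorem IsIndecomposableModule.isUnit_or_isUnit_one_sub (hR : IsBaseRing R) (hN : IsLattice R N)
    (h : IsIndecomposableModule A N) (u : Module.End A N) : IsUnit u ∨ IsUnit (1 - u) := by
  have := hR.isLocalRing
  have := hR.isNoetherianRing
  have := hR.isAdicComplete
  have := hN.finite
  have : Module.Finite R (Module.End A N) :=
    Module.Finite.of_injective (LinearMap.restrictScalarsₗ R A N N R)
      (LinearMap.restrictScalars_injective R)
  exact isUnit_or_isUnit_one_sub_of_idempotents_trivial (R := R) h.eq_zero_or_one u

/-- If the identity of an indecomposable lattice is a sum of two endomorphisms, each factoring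
through a module, then the lattice is a retract of one of the two modules. -/
theorem IsIndecomposableModule.retract_or_retract (hR : IsBaseRing R) (hN : IsLattice R N)
    (h : IsIndecomposableModule A N) (i : N →ₗ[A] X) (p : X →ₗ[A] N) (j : N →ₗ[A] Y)
    (q : Y →ₗ[A] N) (hsum : p ∘ₗ i + q ∘ₗ j = LinearMap.id) :
    (∃ p' : X →ₗ[A] N, p' ∘ₗ i = LinearMap.id) ∨ ∃ q' : Y →ₗ[A] N, q' ∘ₗ j = LinearMap.id := by
  have key : ∀ u : Module.End A N, IsUnit u → ∃ v : Module.End A N, v ∘ₗ u = LinearMap.id :=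
    fun u hu => ⟨_, hu.unit.inv_mul⟩
  rcases h.isUnit_or_isUnit_one_sub hR hN (p ∘ₗ i) with hu | hu
  · obtain ⟨v, hv⟩ := key _ hu
    exact Or.inl ⟨v ∘ₗ p, hv⟩
  · have : (1 : Module.End A N) - p ∘ₗ i = q ∘ₗ j := sub_eq_of_eq_add' hsum.symm
    rw [this] at hu
    obtain ⟨v, hv⟩ := key _ hu
    exact Or.inr ⟨v ∘ₗ q, hv⟩

theorem IsIndecomposableModule.retract_of_retract_pi (hR : IsBaseRing R) (hN : IsLattice R N)
    (h : IsIndecomposableModule A N) {r : ℕ} (i : N →ₗ[A] (Fin r → X)) (p : (Fin r → X) →ₗ[A] N)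
    (hpi : p ∘ₗ i = LinearMap.id) :
    ∃ (j : N →ₗ[A] X) (q : X →ₗ[A] N), q ∘ₗ j = LinearMap.id := by
  induction r with
  | zero =>
    have := h.1
    obtain ⟨x, hx⟩ := exists_ne (0 : N)
    refine absurd ?_ hx
    have h0 : i x = 0 := Subsingleton.elim _ _
    have h1 : p (i x) = x := LinearMap.congr_fun hpi x
    rw [← h1, h0, map_zero]
  | succ r ih =>
    let e := Fin.consLinearEquiv A (fun _ : Fin (r + 1) => X)
    have hsum : (p ∘ₗ e.toLinearMap ∘ₗ LinearMap.inl A X (Fin r → X)) ∘ₗ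
        (LinearMap.fst A X (Fin r → X) ∘ₗ e.symm.toLinearMap ∘ₗ i) +
        (p ∘ₗ e.toLinearMap ∘ₗ LinearMap.inr A X (Fin r → X)) ∘ₗ
        (LinearMap.snd A X (Fin r → X) ∘ₗ e.symm.toLinearMap ∘ₗ i) = LinearMap.id := by
      rw [← hpi]
      ext x
      simp only [LinearMap.add_apply, LinearMap.comp_apply, ← map_add]
      congr 1
      refine Eq.trans (congrArg e ?_) (e.apply_symm_apply (i x))
      ext <;> simp
    rcases h.retract_or_retract hR hN _ _ _ _ hsum with ⟨p', hp'⟩ | ⟨q', hq'⟩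
    · exact ⟨_, p', hp'⟩
    · exact ih _ q' hq'

/-- Lattices without summands in the additive closure of `B` are closed under direct sums. -/
theorem HasNoSummandIn.prod (hR : IsBaseRing R) {B : Type u} [AddCommGroup B] [Module R B]
    [Module A B] [IsScalarTower R A B] (hB : IsLattice R B)
    (hM : HasNoSummandIn A B M) (hN : HasNoSummandIn A B N) : HasNoSummandIn A B (M × N) := by
  have := hR.isNoetherianRing
  intro P Q hPQ hP
  by_contra hne
  have := (Submodule.nontrivial_iff_ne_bot).mpr hne
  have hPlat : IsLattice R P := hP.isLattice hB
  have := hPlat.isNoetherian (A := A)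
  obtain ⟨p, hp⟩ := Submodule.exists_retraction hPQ
  obtain ⟨P', Q', hPQ', hind⟩ := exists_indecomposable_retract (A := A) (M := P)
  obtain ⟨p', hp'⟩ := Submodule.exists_retraction hPQ'
  have hP' : IsSummandOfMultiple A P' B := hP.of_retract _ _ hp'
  have hsum : (p' ∘ₗ p ∘ₗ LinearMap.inl A M N) ∘ₗ
      (LinearMap.fst A M N ∘ₗ P.subtype ∘ₗ P'.subtype) +
      (p' ∘ₗ p ∘ₗ LinearMap.inr A M N) ∘ₗ
      (LinearMap.snd A M N ∘ₗ P.subtype ∘ₗ P'.subtype) = LinearMap.id := by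
    rw [← hp']
    refine LinearMap.ext fun x => ?_
    simp only [LinearMap.add_apply, LinearMap.comp_apply, ← map_add]
    refine congrArg p' (Eq.trans (congrArg p ?_) (LinearMap.congr_fun hp (P'.subtype x)))
    ext <;> simp
  have hnon := hind.1
  rcases hind.retract_or_retract hR (hPlat.submodule P') _ _ _ _ hsum with ⟨q, hq⟩ | ⟨q, hq⟩
  · exact not_nontrivial_iff_subsingleton.mpr (hM.subsingleton_of_retract hP' _ q hq) hnon
  · exact not_nontrivial_iff_subsingleton.mpr (hN.subsingleton_of_retract hP' _ q hq) hnon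

end LocalEndomorphisms

/-! ### Action of fractions on lattices and the rejection ring -/

section KAlg

variable {R A : Type u} [CommRing R] [Ring A] [Algebra R A]

/-- `KA` is the localization of `A` at the regular elements of `R`. -/
instance isLocalizedModule_toKAlg : IsLocalizedModule R⁰ (toKAlg R A).toLinearMap :=
  (isLocalizedModule_iff_isBaseChange R⁰ (FractionRing R) _).mpr
    (TensorProduct.isBaseChange R A (FractionRing R))

theorem exists_smul_eq_toKAlg (x : KAlg R A) : ∃ s ∈ R⁰, ∃ a : A, s • x = toKAlg R A a := by
  obtain ⟨⟨a, s⟩, h⟩ := IsLocalizedModule.surj R⁰ (toKAlg R A).toLinearMap x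
  exact ⟨s, s.2, a, h⟩

theorem exists_smul_eq_self {s : R} (hs : s ∈ R⁰) (x : KAlg R A) : ∃ y, s • y = x := by
  obtain ⟨y, hy⟩ := (Module.End.isUnit_iff _).mp
    (IsLocalizedModule.map_units (toKAlg R A).toLinearMap ⟨s, hs⟩) |>.2 x
  exact ⟨y, hy⟩

theorem smul_cancel_KAlg {s : R} (hs : s ∈ R⁰) {x y : KAlg R A} (h : s • x = s • y) : x = y :=
  IsLocalizedModule.smul_injective (toKAlg R A).toLinearMap ⟨s, hs⟩ h

theorem toKAlg_injective (hA : IsLattice R A) : Function.Injective (toKAlg R A) := by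
  intro a b h
  obtain ⟨s, hs⟩ := IsLocalizedModule.exists_of_eq (S := R⁰) (f := (toKAlg R A).toLinearMap) h
  exact hA.regular_smul_cancel s.2 hs

end KAlg

section FracAct

variable {R A : Type u} [CommRing R] [Ring A] [Algebra R A]
variable {M : Type u} [AddCommGroup M] [Module R M] [Module A M] [IsScalarTower R A M]
  {N : Type u} [AddCommGroup N] [Module R N] [Module A N] [IsScalarTower R A N]

/-- `FracAct x m m'` says that `x • m = m'` in `K ⊗ M`, expressed inside `M` by clearing the
denominator of `x`. -/
def FracAct (x : KAlg R A) (m m' : M) : Prop :=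
  ∃ s ∈ R⁰, ∃ a : A, s • x = toKAlg R A a ∧ s • m' = a • m

theorem fracAct_toKAlg {M : Type u} [AddCommGroup M] [Module R M] [Module A M] (a : A) (m : M) :
    FracAct (toKAlg R A a) m (a • m) :=
  ⟨1, one_mem _, a, by rw [one_smul], by rw [one_smul]⟩

namespace FracAct

theorem smul_eq (hA : IsLattice R A) (hM : IsLattice R M) {x : KAlg R A} {m m' : M}
    (h : FracAct x m m') {t : R} {b : A} (hb : t • x = toKAlg R A b) : t • m' = b • m := by
  obtain ⟨s, hs, a, ha, hm⟩ := h
  have hab : t • a = s • b := toKAlg_injective hA (by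
    rw [map_smul, map_smul, ← ha, ← hb, smul_comm])
  refine hM.regular_smul_cancel hs ?_
  rw [smul_comm, hm, ← smul_assoc, hab, smul_assoc]

theorem unique (hA : IsLattice R A) (hM : IsLattice R M) {x : KAlg R A} {m m₁ m₂ : M}
    (h₁ : FracAct x m m₁) (h₂ : FracAct x m m₂) : m₁ = m₂ := by
  obtain ⟨s, hs, a, ha, hm⟩ := h₁
  exact hM.regular_smul_cancel hs (hm.trans (h₂.smul_eq hA hM ha).symm)

theorem add_right {x : KAlg R A} {m n m' n' : M} (hA : IsLattice R A) (hM : IsLattice R M)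
    (h₁ : FracAct x m m') (h₂ : FracAct x n n') : FracAct x (m + n) (m' + n') := by
  obtain ⟨s, hs, a, ha, hm⟩ := h₁
  exact ⟨s, hs, a, ha, by rw [smul_add, smul_add, hm, h₂.smul_eq hA hM ha]⟩

theorem add_left {x y : KAlg R A} {m m' m'' : M}
    (h₁ : FracAct x m m') (h₂ : FracAct y m m'') : FracAct (x + y) m (m' + m'') := by
  obtain ⟨s, hs, a, ha, hm⟩ := h₁
  obtain ⟨t, ht, b, hb, hn⟩ := h₂
  refine ⟨s * t, mul_mem hs ht, t • a + s • b, ?_, ?_⟩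
  · rw [map_add, map_smul, map_smul, ← ha, ← hb, smul_add, mul_comm s t, mul_smul, mul_comm t s,
      mul_smul]
  · rw [add_smul, smul_assoc, smul_assoc, ← hm, ← hn, smul_add, mul_comm s t, mul_smul,
      mul_comm t s, mul_smul]

theorem mul {x y : KAlg R A} {m m' m'' : M}
    (h₁ : FracAct y m m') (h₂ : FracAct x m' m'') : FracAct (x * y) m m'' := by
  obtain ⟨t, ht, b, hb, hm⟩ := h₁
  obtain ⟨s, hs, a, ha, hn⟩ := h₂
  refine ⟨t * s, mul_mem ht hs, a * b, ?_, ?_⟩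
  · rw [map_mul, ← ha, ← hb, mul_comm t s, smul_mul_smul_comm]
  · rw [mul_smul, hn, mul_smul, ← hm, smul_comm]

theorem map {x : KAlg R A} {m m' : M} (h : FracAct x m m') (f : M →ₗ[A] N) :
    FracAct x (f m) (f m') := by
  obtain ⟨s, hs, a, ha, hm⟩ := h
  refine ⟨s, hs, a, ha, ?_⟩
  exact ((f.restrictScalars R).map_smul s m').symm.trans ((congrArg f hm).trans (f.map_smul a m))

end FracAct

/-- The element `x` of `KA` maps the lattice `M ⊆ K ⊗ M` into itself. -/
def Stabilizes (x : KAlg R A) (M : Type u) [AddCommGroup M] [Module R M] [Module A M] : Prop :=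
  ∀ m : M, ∃ m' : M, FracAct x m m'

theorem Stabilizes.of_retract {x : KAlg R A} (h : Stabilizes x M) (i : N →ₗ[A] M)
    (p : M →ₗ[A] N) (hpi : p ∘ₗ i = LinearMap.id) : Stabilizes x N := by
  intro n
  obtain ⟨m', hm'⟩ := h (i n)
  have := hm'.map p
  rw [show p (i n) = n from LinearMap.congr_fun hpi n] at this
  exact ⟨_, this⟩

theorem Stabilizes.pi (hA : IsLattice R A) (hM : IsLattice R M) {x : KAlg R A}
    (h : Stabilizes x M) (r : ℕ) : Stabilizes x (Fin r → M) := by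
  intro m
  obtain ⟨s, hs, a, ha⟩ := exists_smul_eq_toKAlg x
  choose m' hm' using fun j => h (m j)
  exact ⟨m', s, hs, a, ha, funext fun j => (hm' j).smul_eq hA hM ha⟩

/-- An `A`-lattice is an `A'`-lattice if and only if it is mapped into itself by `A'`. -/
theorem isModuleOver_iff_stabilizes (hA : IsLattice R A) (hM : IsLattice R M)
    {A' : Subalgebra R (KAlg R A)} :
    IsModuleOver R A M A' ↔ ∀ x ∈ A', Stabilizes x M := by
  constructor
  · rintro ⟨_, h⟩ x hx m
    obtain ⟨s, hs, a, ha⟩ := exists_smul_eq_toKAlg x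
    refine ⟨(⟨x, hx⟩ : A') • m, s, hs, a, ha, ?_⟩
    have h1 : algebraMap R A s • (⟨x, hx⟩ : A') • m = (algebraMap R A' s * ⟨x, hx⟩) • m := by
      rw [mul_smul]
      exact (h (algebraMap R A s) _ _ ((toKAlg R A).commutes s).symm).symm
    rw [← algebraMap_smul A, h1]
    refine h a _ m ?_
    rw [← ha, Algebra.smul_def s x]
    rfl
  · intro h
    choose f hf using fun (x : A') (m : M) => h x x.2 m
    have huniq : ∀ (x : A') (m m' : M), FracAct (x : KAlg R A) m m' → f x m = m' :=
      fun x m m' h' => (hf x m).unique hA hM h'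
    refine ⟨{ smul := f
              one_smul := fun m => huniq _ _ _ ?_
              mul_smul := fun x y m => huniq _ _ _ ((hf y m).mul (hf x _))
              smul_zero := fun x => huniq _ _ _ ?_
              smul_add := fun x m n => huniq _ _ _ ((hf x m).add_right hA hM (hf x n))
              add_smul := fun x y m => huniq _ _ _ ((hf x m).add_left (hf y m))
              zero_smul := fun m => huniq _ _ _ ?_ }, fun a x m hx => huniq _ _ _ ?_⟩
    · have := fracAct_toKAlg (R := R) (1 : A) m
      rwa [map_one, one_smul] at this
    · obtain ⟨s, hs, a, ha⟩ := exists_smul_eq_toKAlg (x : KAlg R A)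
      exact ⟨s, hs, a, ha, by rw [smul_zero, smul_zero]⟩
    · have := fracAct_toKAlg (R := R) (0 : A) m
      rwa [map_zero, zero_smul] at this
    · rw [hx]
      exact fracAct_toKAlg a m

end FracAct

section RejectionRing

variable {R A : Type u} [CommRing R] [Ring A] [Algebra R A]

/-- The ring `A⁻(B)`: the elements of `KA` which map into itself every `A`-lattice without nonzero
direct summands in the additive closure of `B`. -/
def rejectionRing (R A B : Type u) [CommRing R] [Ring A] [Algebra R A]
    [AddCommGroup B] [Module A B] :
    Subalgebra R (KAlg R A) where
  carrier := {x | ∀ (M : Type u) [AddCommGroup M] [Module R M] [Module A M] [IsScalarTower R A M],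
    IsLattice R M → HasNoSummandIn A B M → Stabilizes x M}
  mul_mem' := fun hx hy M _ _ _ _ hM hMB m => by
    obtain ⟨m', hm'⟩ := hy M hM hMB m
    obtain ⟨m'', hm''⟩ := hx M hM hMB m'
    exact ⟨m'', hm'.mul hm''⟩
  add_mem' := fun hx hy M _ _ _ _ hM hMB m => by
    obtain ⟨m', hm'⟩ := hx M hM hMB m
    obtain ⟨m'', hm''⟩ := hy M hM hMB m
    exact ⟨m' + m'', hm'.add_left hm''⟩
  algebraMap_mem' := fun r M _ _ _ _ hM hMB m => by
    refine ⟨algebraMap R A r • m, ?_⟩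
    have := fracAct_toKAlg (R := R) (algebraMap R A r) m
    rwa [(toKAlg R A).commutes r] at this

theorem range_toKAlg_le_rejectionRing (B : Type u) [AddCommGroup B]
    [Module A B] : (toKAlg R A).range ≤ rejectionRing R A B := by
  rintro _ ⟨a, rfl⟩ M _ _ _ _ _ _ m
  exact ⟨a • m, fracAct_toKAlg a m⟩

end RejectionRing

/-! ### The rejection ring moves every summand of the bijective lattice -/

section

variable {R A : Type u} [CommRing R] [Ring A] [Algebra R A]
variable {M : Type u} [AddCommGroup M] [Module R M] [Module A M] [IsScalarTower R A M]
variable {N : Type u} [AddCommGroup N] [Module R N] [Module A N] [IsScalarTower R A N]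

/-- Multiplication by an element of `R`, as an `A`-linear endomorphism. -/
abbrev smulEnd (A N : Type u) [Ring A] [Algebra R A] [AddCommGroup N] [Module R N] [Module A N]
    [IsScalarTower R A N] (r : R) : N →ₗ[A] N := algebraMap R (Module.End A N) r

theorem smulEnd_apply (r : R) (n : N) : smulEnd A N r n = r • n := rfl

/-- There is a submodule minimal among those strictly containing `rN`. Multiplied by `r⁻¹`, it is a
minimal overlattice of `N`. -/
theorem exists_range_smulEnd_covBy (hR : IsBaseRing R) (hN : IsLattice R N) [Nontrivial N]
    [IsLocalRing R] {r : R} (hr : r ∈ R⁰) (hrm : r ∈ IsLocalRing.maximalIdeal R) :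
    ∃ L : Submodule A N, LinearMap.range (smulEnd A N r) ⋖ L := by
  have := hN.finite
  have := hR.isArtinianRing_quotient hr
  set P := LinearMap.range (smulEnd A N r)
  have hart : IsArtinian A (N ⧸ P) := by
    have htors : Module.IsTorsionBySet R (N ⧸ P) (Ideal.span {r}) := by
      rintro z ⟨a, ha⟩
      obtain ⟨n, rfl⟩ := P.mkQ_surjective z
      obtain ⟨b, rfl⟩ := Ideal.mem_span_singleton'.mp ha
      exact (Submodule.Quotient.mk_eq_zero P).mpr ⟨b • n, by rw [smulEnd_apply, smul_smul, mul_comm]⟩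
    let := htors.module
    have := htors.isScalarTower (S := R)
    have : Module.Finite (R ⧸ Ideal.span {r}) (N ⧸ P) :=
      Module.Finite.of_restrictScalars_finite R _ _
    have : IsArtinian R (N ⧸ P) :=
      isArtinian_of_surjective_algebraMap (R := R ⧸ Ideal.span {r}) Ideal.Quotient.mk_surjective
    exact isArtinian_of_tower R this
  have hnt : Nontrivial (N ⧸ P) := by
    rw [Submodule.Quotient.nontrivial_iff]
    intro h
    have htop : (⊤ : Submodule R N) ≤ IsLocalRing.maximalIdeal R • (⊤ : Submodule R N) := by
      intro n _
      have : n ∈ P := h ▸ Submodule.mem_top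
      obtain ⟨n', rfl⟩ := this
      exact Submodule.smul_mem_smul hrm Submodule.mem_top
    have := Submodule.eq_bot_of_le_smul_of_le_jacobson_bot _ _ Module.Finite.fg_top htop
      (IsLocalRing.maximalIdeal_le_jacobson _)
    exact top_ne_bot this
  obtain ⟨a, ha, -⟩ := (IsAtomic.eq_bot_or_exists_atom_le (⊤ : Submodule A (N ⧸ P))).resolve_left
    top_ne_bot
  refine ⟨a.comap P.mkQ, ?_⟩
  have := Submodule.comap_covBy_of_surjective P.mkQ_surjective ha.bot_covBy
  rwa [Submodule.comap_bot, Submodule.ker_mkQ] at this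

/-- A map `φ` from an indecomposable L-injective lattice `N` to a lattice `M` without summand `N`
extends to every minimal overlattice of `N`. Here the overlattice is `r⁻¹L`, with `L ⊆ N` minimal
over `rN`. -/
theorem exists_smul_eq_of_covBy (hR : IsBaseRing R) {B : Type u} [AddCommGroup B] [Module R B]
    [Module A B] [IsScalarTower R A B] (hB : IsBijectiveLattice R A B)
    (hNB : IsSummandOfMultiple A N B) (hind : IsIndecomposableModule A N)
    {r : R} (hr : r ∈ R⁰) {L : Submodule A N} (hL : LinearMap.range (smulEnd A N r) ⋖ L)
    (hM : IsLattice R M) (hMB : HasNoSummandIn A B M) (φ : N →ₗ[A] M) {n : N} (hn : n ∈ L) :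
    ∃ m : M, r • m = φ n := by
  have := hR.isNoetherianRing
  have hN : IsLattice R N := hNB.isLattice hB.isLattice
  have hLlat : IsLattice R L := hN.submodule L
  set P := LinearMap.range (smulEnd A N r)
  have hLM := hLlat.prod hM
  have hφr : ∀ (s : R) (x : N), φ (s • x) = s • φ x := (φ.toBase R).map_smul
  let L' : Submodule A N := L ⊓ (LinearMap.range (smulEnd A M r)).comap φ
  have hPL' : P ≤ L' := by
    rintro _ ⟨x, rfl⟩
    exact ⟨hL.le ⟨x, rfl⟩, φ x, (hφr r x).symm⟩
  rcases hL.eq_or_eq hPL' inf_le_left with h | h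
  · -- `φ` does not extend to `L`, so `n ↦ (rn, φ n)` has torsion free cokernel in `L × M`
    exfalso
    let ι : N →ₗ[A] L := (smulEnd A N r).codRestrict L fun x => hL.le ⟨x, rfl⟩
    let f : N →ₗ[A] L × M := ι.prod φ
    have hιval : ∀ x, (ι x : N) = r • x := fun x => rfl
    have hf : Function.Injective f := fun x y hxy =>
      hN.regular_smul_cancel hr (congrArg (fun z => (z.1 : N)) hxy)
    have hcok : IsLattice R ((L × M) ⧸ LinearMap.range f) := by
      have := hLM.finite
      refine IsLattice.of_smul_eq_zero fun s hs z hz => ?_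
      obtain ⟨⟨l, m⟩, rfl⟩ := (LinearMap.range f).mkQ_surjective z
      obtain ⟨x, hx⟩ : s • (l, m) ∈ LinearMap.range f := (Submodule.Quotient.mk_eq_zero _).mp hz
      have h1 : r • x = s • (l : N) := congrArg (fun z => (z.1 : N)) hx
      have h2 : φ x = s • m := congrArg Prod.snd hx
      -- `l` lies in `rN`, since `φ` maps it to the multiple `rm`
      have h3 : (l : N) ∈ P := by
        rw [← h]
        refine ⟨l.2, m, ?_⟩
        refine hM.regular_smul_cancel hs ?_
        rw [smulEnd_apply, smul_comm, ← h2, ← hφr, h1, hφr]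
      obtain ⟨y, hy⟩ := h3
      have hxy : x = s • y := hN.regular_smul_cancel hr (by
        rw [h1, ← hy, smulEnd_apply, smul_comm])
      refine (Submodule.Quotient.mk_eq_zero _).mpr ⟨y, Prod.ext (Subtype.ext hy) ?_⟩
      refine hM.regular_smul_cancel hs ?_
      change s • φ y = s • m
      rw [← h2, hxy, hφr]
    obtain ⟨ρ, hρ⟩ := hB.isLInjective.exists_retraction hNB f hf hcok
    have hsum : (ρ ∘ₗ LinearMap.inl A L M) ∘ₗ ι + (ρ ∘ₗ LinearMap.inr A L M) ∘ₗ φ =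
        LinearMap.id := by
      rw [← hρ]
      refine LinearMap.ext fun x => ?_
      simp only [LinearMap.add_apply, LinearMap.comp_apply, ← map_add]
      refine congrArg ρ ?_
      ext <;> simp [f]
    rcases hind.retract_or_retract hR hN _ _ _ _ hsum with ⟨q, hq⟩ | ⟨q, hq⟩
    · -- a retraction of `rN ⊆ L` is injective, since `rL ⊆ rN`; so `L = rN`
      have hq' : ∀ x, q (ι x) = x := LinearMap.congr_fun hq
      refine hL.lt.not_ge fun l hl => ?_
      have hql : ι (q ⟨l, hl⟩) = ⟨l, hl⟩ := by
        refine hLlat.regular_smul_cancel hr ?_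
        have h1 : ι l = r • (⟨l, hl⟩ : L) := Subtype.ext (hιval l)
        have h2 : q (r • (⟨l, hl⟩ : L)) = r • q ⟨l, hl⟩ := (q.toBase R).map_smul r _
        have h3 : r • ι (q ⟨l, hl⟩) = ι (r • q ⟨l, hl⟩) := ((ι.toBase R).map_smul r _).symm
        rw [h3, ← h2, ← h1, hq', h1]
      exact ⟨q ⟨l, hl⟩, congrArg Subtype.val hql⟩
    · exact not_nontrivial_iff_subsingleton.mpr (hMB.subsingleton_of_retract hNB φ q hq) hind.1
  · obtain ⟨-, m, hm⟩ : n ∈ L' := h ▸ hn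
    exact ⟨m, hm⟩

/-- `A⁻(B)` rejects `B`: no nonzero lattice in the additive closure of `B` is stable under
`A⁻(B)`. -/
theorem subsingleton_of_rejectionRing_stabilizes (hR : IsBaseRing R) (hA : IsLattice R A)
    {B : Type u} [AddCommGroup B] [Module R B]
    [Module A B] [IsScalarTower R A B] (hB : IsBijectiveLattice R A B)
    (hNB : IsSummandOfMultiple A N B) (h : ∀ x ∈ rejectionRing R A B, Stabilizes x N) :
    Subsingleton N := by
  have := hR.isNoetherianRing
  have := hR.isLocalRing
  have hN : IsLattice R N := hNB.isLattice hB.isLattice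
  have := hN.isNoetherian (A := A)
  by_contra hne
  rw [not_subsingleton_iff_nontrivial] at hne
  obtain ⟨N', Q, hN'Q, hind⟩ := exists_indecomposable_retract (A := A) (M := N)
  obtain ⟨p, hp⟩ := Submodule.exists_retraction hN'Q
  have hN'B := hNB.of_retract _ _ hp
  have hN' := hN.submodule N'
  have := hind.1
  obtain ⟨r, hrm, hr⟩ := hR.exists_regular_mem_maximalIdeal
  obtain ⟨L, hL⟩ := exists_range_smulEnd_covBy (A := A) hR hN' hr hrm
  have := hB.projective
  have := hN'B.projective
  have : Module.Finite A N' := inferInstance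
  obtain ⟨k, f, g, -, -, hfg⟩ := Module.Finite.exists_comp_eq_id_of_projective A N'
  refine hL.lt.not_ge fun n hn => ?_
  -- `x j = r⁻¹ g(n)_j` lies in the ring, so that `r⁻¹ n = ∑ j, x j • f (e j)` lies in `N'`
  choose x hx using fun j => exists_smul_eq_self hr (toKAlg R A (g n j))
  have hxmem : ∀ j, x j ∈ rejectionRing R A B := fun j M _ _ _ _ hM hMB m => by
    obtain ⟨m', hm'⟩ := exists_smul_eq_of_covBy hR hB hN'B hind hr hL hM hMB
      ((LinearMap.toSpanSingleton A M m) ∘ₗ (LinearMap.proj j) ∘ₗ g) hn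
    exact ⟨m', r, hr, g n j, hx j, hm'⟩
  choose y hy using fun j => (h (x j) (hxmem j)).of_retract _ _ hp (f fun i => if j = i then 1 else 0)
  refine ⟨∑ j, y j, ?_⟩
  have h1 : f (g n) = n := LinearMap.congr_fun hfg n
  rw [smulEnd_apply, Finset.smul_sum, ← h1, LinearMap.pi_apply_eq_sum_univ f (g n)]
  exact Finset.sum_congr rfl fun j _ => (hy j).smul_eq hA hN' (hx j)

end

/-! ### Semiprime rings and the common annihilator -/

section Semiprime

variable {A : Type u} [Ring A]

theorem HasNoNilpotentIdeals.eq_bot_of_mul_eq_zero (h : HasNoNilpotentIdeals A) (I : Ideal A)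
    [hI : I.IsTwoSided] (hsq : ∀ x ∈ I, ∀ y ∈ I, x * y = 0) : I = ⊥ := by
  refine h I hI ⟨2, ?_⟩
  rw [Submodule.pow_succ, Submodule.pow_one]
  exact le_bot_iff.mp (Ideal.mul_le.mpr fun x hx y hy => hsq x hx y hy)

theorem hasNoNilpotentIdeals_of_mul_eq_zero
    (h : ∀ I : Ideal A, I.IsTwoSided → (∀ x ∈ I, ∀ y ∈ I, x * y = 0) → I = ⊥) :
    HasNoNilpotentIdeals A := by
  rintro I hI ⟨n, hn⟩
  induction n with
  | zero =>
    rw [Submodule.pow_zero] at hn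
    exact le_bot_iff.mp ((le_top.trans_eq Ideal.one_eq_top.symm).trans_eq hn)
  | succ n ih =>
    rcases n with _ | n
    · rwa [zero_add, Submodule.pow_one] at hn
    · refine ih (h _ inferInstance fun x hx y hy => ?_)
      have : I ^ (n + 1) * I ^ (n + 1) ≤ ⊥ := by
        rw [← Ideal.IsTwoSided.pow_add, show n + 1 + (n + 1) = (n + 1 + 1) + n by ring]
        exact (Ideal.pow_le_pow_right (by omega)).trans_eq hn
      exact this (Ideal.mul_mem_mul hx hy)

/-- Being semiprime passes to a ring extension in which every nonzero element has a nonzero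
left multiple in the smaller ring. -/
theorem HasNoNilpotentIdeals.of_ringHom {C : Type u} [Ring C] (h : HasNoNilpotentIdeals A)
    (φ : A →+* C) (hφ : Function.Injective φ)
    (hmul : ∀ x : C, x ≠ 0 → ∃ (c : C) (a : A), c * x = φ a ∧ c * x ≠ 0) :
    HasNoNilpotentIdeals C := by
  refine hasNoNilpotentIdeals_of_mul_eq_zero fun I hI hsq => ?_
  have hbot : I.comap φ = ⊥ := h.eq_bot_of_mul_eq_zero _ fun x hx y hy => hφ (by
    rw [map_mul, map_zero]
    exact hsq _ hx _ hy)
  rw [eq_bot_iff]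
  intro x hx
  by_contra hx0
  obtain ⟨c, a, hca, hne⟩ := hmul x hx0
  have : a ∈ I.comap φ := by
    rw [Ideal.mem_comap, ← hca]
    exact I.mul_mem_left c hx
  rw [hbot] at this
  rw [hca, (Ideal.mem_bot.mp this), map_zero] at hne
  exact hne rfl

/-- The right annihilator `{a | J a = 0}` of a two-sided ideal `J`, which is again two-sided. -/
def Ideal.rightAnnihilator (J : Ideal A) [J.IsTwoSided] : Ideal A where
  carrier := {a | ∀ j ∈ J, j * a = 0}
  zero_mem' := fun j _ => mul_zero j
  add_mem' := fun ha hb j hj => by rw [mul_add, ha j hj, hb j hj, add_zero]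
  smul_mem' := fun c a ha j hj => by
    rw [smul_eq_mul, ← mul_assoc]
    exact ha _ (J.mul_mem_right c hj)

instance (J : Ideal A) [J.IsTwoSided] : J.rightAnnihilator.IsTwoSided :=
  ⟨fun {a} b ha j hj => by rw [← mul_assoc, ha j hj, zero_mul]⟩

theorem HasNoNilpotentIdeals.inf_rightAnnihilator (h : HasNoNilpotentIdeals A) (J : Ideal A)
    [J.IsTwoSided] : J ⊓ J.rightAnnihilator = ⊥ :=
  h.eq_bot_of_mul_eq_zero _ (hI := ⟨fun b ha => ⟨J.mul_mem_right b ha.1,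
    J.rightAnnihilator.mul_mem_right b ha.2⟩⟩) fun x hx _ hy => hy.2 x hx.1

/-- In a semiprime ring a right identity of a two-sided ideal is a central idempotent. -/
theorem HasNoNilpotentIdeals.mem_center_of_right_identity (h : HasNoNilpotentIdeals A)
    (I : Ideal A) [I.IsTwoSided] {f : A} (hf : f ∈ I) (hid : ∀ x ∈ I, x * f = x) :
    f ∈ Subring.center A := by
  have h1 : ∀ a, f * a * f = f * a := fun a => hid _ (I.mul_mem_right a hf)
  rw [Subring.mem_center_iff]
  intro a
  have : a * f - f * a * f ∈ I ⊓ I.rightAnnihilator := by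
    refine ⟨I.sub_mem (I.mul_mem_left a hf) (I.mul_mem_left _ hf), fun y hy => ?_⟩
    rw [mul_sub, ← mul_assoc, ← mul_assoc, ← mul_assoc, hid y hy, sub_self]
  rw [h.inf_rightAnnihilator, Ideal.mem_bot, sub_eq_zero, h1] at this
  exact this

end Semiprime

section Order

variable {R A : Type u} [CommRing R] [Ring A] [Algebra R A]

theorem KAlg.isArtinianRing (hR : IsBaseRing R) (hA : IsLattice R A) :
    IsArtinianRing (KAlg R A) := by
  have := hR.isNoetherianRing
  have := hR.isReduced
  have := IsReduced.isArtinianRing_fractionRing R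
  have := hA.finite
  exact IsArtinianRing.of_finite (FractionRing R) _

theorem KAlg.isSemisimpleRing (hR : IsBaseRing R) (hA : IsROrder R A) :
    IsSemisimpleRing (KAlg R A) := by
  have := KAlg.isArtinianRing hR hA.isLattice
  rw [IsArtinianRing.isSemisimpleRing_iff_jacobson]
  have hsp : HasNoNilpotentIdeals (KAlg R A) :=
    hA.semiprime.of_ringHom (toKAlg R A).toRingHom (toKAlg_injective hA.isLattice) fun x hx => by
      obtain ⟨s, hs, a, ha⟩ := exists_smul_eq_toKAlg x
      refine ⟨algebraMap R _ s, a, ?_, fun h => hx ?_⟩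
      · rw [← Algebra.smul_def]; exact ha
      · rw [← Algebra.smul_def] at h
        exact smul_cancel_KAlg hs (h.trans (smul_zero s).symm)
  exact hsp _ inferInstance IsSemiprimaryRing.isNilpotent

variable (R A) in
/-- The common annihilator in `A` of the lattices without summands in the additive closure
of `B`. -/
def commonAnnihilator (B : Type u) [AddCommGroup B] [Module A B] : Ideal A where
  carrier := {a | ∀ (M : Type u) [AddCommGroup M] [Module R M] [Module A M] [IsScalarTower R A M],
    IsLattice R M → HasNoSummandIn A B M → ∀ m : M, a • m = 0}
  zero_mem' := fun M _ _ _ _ _ _ m => zero_smul A m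
  add_mem' := fun ha hb M _ _ _ _ hM hMB m => by
    rw [add_smul, ha M hM hMB, hb M hM hMB, add_zero]
  smul_mem' := fun c a ha M _ _ _ _ hM hMB m => by
    rw [smul_eq_mul, mul_smul, ha M hM hMB, smul_zero]

instance (B : Type u) [AddCommGroup B] [Module A B] : (commonAnnihilator R A B).IsTwoSided :=
  ⟨fun {a} b ha M _ _ _ _ hM hMB m => by rw [mul_smul]; exact ha M hM hMB _⟩

/-- As `KA` is semisimple, a two-sided ideal of `A` with zero right annihilator contains a regular
element of `R`. -/
theorem exists_regular_mem_of_rightAnnihilator_eq_bot (hR : IsBaseRing R) (hA : IsROrder R A)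
    (J : Ideal A) [J.IsTwoSided] (h : J.rightAnnihilator = ⊥) :
    ∃ s ∈ R⁰, algebraMap R A s ∈ J := by
  have := KAlg.isSemisimpleRing hR hA
  have hinj := toKAlg_injective hA.isLattice
  obtain ⟨e, he, hspan⟩ := IsSemisimpleRing.ideal_eq_span_idempotent
    (Ideal.span (toKAlg R A '' J))
  have hfrac : ∀ x ∈ Ideal.span (toKAlg R A '' J), ∃ s ∈ R⁰, ∃ j ∈ J, s • x = toKAlg R A j := by
    intro x hx
    induction hx using Submodule.span_induction with
    | mem x hx =>
      obtain ⟨j, hj, rfl⟩ := hx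
      exact ⟨1, one_mem _, j, hj, one_smul _ _⟩
    | zero => exact ⟨1, one_mem _, 0, J.zero_mem, by rw [smul_zero, map_zero]⟩
    | add x y _ _ hx hy =>
      obtain ⟨s, hs, j, hj, hsj⟩ := hx
      obtain ⟨t, ht, k, hk, htk⟩ := hy
      refine ⟨s * t, mul_mem hs ht, t • j + s • k, J.add_mem ?_ ?_, ?_⟩
      · rw [Algebra.smul_def]; exact J.mul_mem_left _ hj
      · rw [Algebra.smul_def]; exact J.mul_mem_left _ hk
      · rw [map_add, map_smul, map_smul, ← hsj, ← htk, smul_add, mul_comm s t, mul_smul,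
          mul_comm t s, mul_smul]
    | smul y x _ hx =>
      obtain ⟨s, hs, j, hj, hsj⟩ := hx
      obtain ⟨t, ht, b, hb⟩ := exists_smul_eq_toKAlg y
      refine ⟨t * s, mul_mem ht hs, b * j, J.mul_mem_left b hj, ?_⟩
      rw [map_mul, ← hsj, ← hb, smul_mul_smul_comm, smul_eq_mul]
  have he1 : e = 1 := by
    obtain ⟨t, ht, a, ha⟩ := exists_smul_eq_toKAlg (1 - e)
    have ha0 : a ∈ J.rightAnnihilator := by
      intro j hj
      have hj' : toKAlg R A j ∈ Ideal.span {e} := hspan ▸ Ideal.subset_span ⟨j, hj, rfl⟩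
      obtain ⟨c, hc⟩ := Ideal.mem_span_singleton'.mp hj'
      refine hinj ?_
      rw [map_mul, ← ha, ← hc, mul_smul_comm, mul_assoc, mul_sub, mul_one, he.eq, sub_self,
        mul_zero, smul_zero, map_zero]
    rw [h, Ideal.mem_bot] at ha0
    rw [ha0, map_zero] at ha
    exact (sub_eq_zero.mp (smul_cancel_KAlg ht (ha.trans (smul_zero t).symm))).symm
  have h1 : (1 : KAlg R A) ∈ Ideal.span (toKAlg R A '' J) := by
    rw [hspan, he1]
    exact Ideal.subset_span rfl
  obtain ⟨s, hs, j, hj, hsj⟩ := hfrac 1 h1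
  refine ⟨s, hs, ?_⟩
  have : algebraMap R A s = j := hinj (by
    rw [← hsj, AlgHom.commutes, Algebra.algebraMap_eq_smul_one])
  exact this ▸ hj

variable {B : Type u} [AddCommGroup B] [Module R B] [Module A B] [IsScalarTower R A B]

theorem IsSummandOfMultiple.of_isCompl_bot {M : Type u} [AddCommGroup M] [Module A M]
    {P Q : Submodule A M} (hPQ : IsCompl P Q) (hP : IsSummandOfMultiple A P B) (hQ : Q = ⊥) :
    IsSummandOfMultiple A M B := by
  obtain rfl : P = ⊤ := by rw [hQ] at hPQ; exact eq_top_of_isCompl_bot hPQ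
  exact hP.of_retract Submodule.topEquiv.symm.toLinearMap Submodule.topEquiv.toLinearMap
    (LinearMap.ext fun x => rfl)

/-- If the lattices without summands in the additive closure of `B` have a nonzero common annihilator
`J`, they all vanish: `A` modulo the right annihilator of `J` is projective, so the right annihilator
is a ring factor of the connected ring `A`, and it is not the whole of `A`. -/
theorem subsingleton_of_commonAnnihilator_ne_bot (hR : IsBaseRing R) (hA : IsROrder R A)
    (hconn : IsConnectedRing A) (hB : IsBijectiveLattice R A B)
    (hJ : commonAnnihilator R A B ≠ ⊥) (M : Type u) [AddCommGroup M] [Module R M] [Module A M]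
    [IsScalarTower R A M] (hM : IsLattice R M) (hMB : HasNoSummandIn A B M) : Subsingleton M := by
  have := hR.isNoetherianRing
  have := hA.isLattice.finite
  set J := commonAnnihilator R A B
  set T := J.rightAnnihilator
  have hinf : J ⊓ T = ⊥ := hA.semiprime.inf_rightAnnihilator J
  have hquot : IsLattice R (A ⧸ T) := by
    refine IsLattice.of_smul_eq_zero fun s hs z hz => ?_
    obtain ⟨a, rfl⟩ := T.mkQ_surjective z
    have hsa : s • a ∈ T := (Submodule.Quotient.mk_eq_zero T).mp hz
    refine (Submodule.Quotient.mk_eq_zero T).mpr fun j hj => ?_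
    refine hA.isLattice.regular_smul_cancel hs ?_
    rw [← mul_smul_comm, hsa j hj, smul_zero]
  -- A summand of `A ⧸ T` killed by `J` vanishes, since `J ⊓ T = ⊥`.
  have hproj : Module.Projective A (A ⧸ T) := by
    have := hquot.isNoetherian (A := A)
    obtain ⟨P, Q, hPQ, hP, hQ⟩ := exists_isCompl_hasNoSummandIn (A := A) (M := A ⧸ T) (B := B)
    have hQ0 : Q = ⊥ := by
      rw [eq_bot_iff]
      intro z hz
      obtain ⟨a, rfl⟩ := T.mkQ_surjective z
      refine (Submodule.Quotient.mk_eq_zero T).mpr fun j hj => ?_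
      have h0 : j • (⟨_, hz⟩ : Q) = 0 := hj Q (hquot.submodule Q) hQ _
      have h1 : j * a ∈ T := (Submodule.Quotient.mk_eq_zero T).mp (congrArg Subtype.val h0)
      have h2 : j * a ∈ J ⊓ T := ⟨J.mul_mem_right a hj, h1⟩
      rwa [hinf] at h2
    have := hB.projective
    exact (IsSummandOfMultiple.of_isCompl_bot hPQ hP hQ0).projective
  -- A section of `A → A ⧸ T` provides a right identity `f` of `T`.
  obtain ⟨σ, hσ⟩ := Module.projective_lifting_property T.mkQ LinearMap.id T.mkQ_surjective
  let f : A := 1 - σ (T.mkQ 1)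
  have hfT : f ∈ T := by
    refine (Submodule.Quotient.mk_eq_zero T).mp ?_
    have : T.mkQ (σ (T.mkQ 1)) = T.mkQ 1 := LinearMap.congr_fun hσ _
    change T.mkQ (1 - σ (T.mkQ 1)) = 0
    rw [map_sub, this, sub_self]
  have hid : ∀ x ∈ T, x * f = x := fun x hx => by
    have h1 : σ (T.mkQ x) = x * σ (T.mkQ 1) := by
      rw [← smul_eq_mul, ← map_smul, ← map_smul, smul_eq_mul, mul_one]
    have h2 : T.mkQ x = 0 := (Submodule.Quotient.mk_eq_zero T).mpr hx
    rw [h2, map_zero] at h1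
    rw [mul_sub, mul_one, ← h1, sub_zero]
  have hT0 : T = ⊥ := by
    rcases hconn.2 f (hid f hfT) (hA.semiprime.mem_center_of_right_identity T hfT hid) with h | h
    · rw [eq_bot_iff]
      intro x hx
      rw [← hid x hx, h, mul_zero]
      exact Submodule.zero_mem _
    · refine absurd (eq_bot_iff.mpr fun j hj => ?_) hJ
      have := hfT j hj
      rwa [h, mul_one] at this
  obtain ⟨s, hs, hsJ⟩ := exists_regular_mem_of_rightAnnihilator_eq_bot hR hA J hT0
  refine subsingleton_of_forall_eq 0 fun m => hM.regular_smul_cancel hs ?_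
  rw [smul_zero, ← algebraMap_smul A]
  exact hsJ M hM hMB m

end Order

/-! ### Overrings -/

section

variable {R A : Type u} [CommRing R] [Ring A] [Algebra R A]

/-- The annihilator of `K ⊗ M` in `KA`, for a lattice `M`. -/
def fracAnnihilator (R A M : Type u) [CommRing R] [Ring A] [Algebra R A] [AddCommGroup M]
    [Module R M] [Module A M] [IsScalarTower R A M] : Ideal (KAlg R A) where
  carrier := {x | ∀ m : M, FracAct x m 0}
  zero_mem' := fun m => by
    have := fracAct_toKAlg (R := R) (0 : A) m
    rwa [map_zero, zero_smul] at this
  add_mem' := fun hx hy m => by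
    have := (hx m).add_left (hy m)
    rwa [add_zero] at this
  smul_mem' := fun y x hx m => by
    refine (hx m).mul ?_
    obtain ⟨s, hs, a, ha⟩ := exists_smul_eq_toKAlg y
    exact ⟨s, hs, a, ha, by rw [smul_zero, smul_zero]⟩

variable {B : Type u} [AddCommGroup B] [Module A B]

/-- If the lattices without summands in the additive closure of `B` have no common annihilator,
one of them is faithful: `KA` is artinian, and these lattices are closed under direct sums. -/
theorem exists_faithful_of_commonAnnihilator_eq_bot [Module R B] [IsScalarTower R A B]
    (hR : IsBaseRing R) (hA : IsLattice R A)
    (hB : IsLattice R B) (hJ : commonAnnihilator R A B = ⊥) :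
    ∃ (M : Type u) (_ : AddCommGroup M) (_ : Module R M) (_ : Module A M)
      (_ : IsScalarTower R A M), IsLattice R M ∧ HasNoSummandIn A B M ∧
      ∀ a : A, (∀ m : M, a • m = 0) → a = 0 := by
  have := KAlg.isArtinianRing hR hA
  obtain ⟨I, ⟨M, _, _, _, _, hM, hMB, rfl⟩, hmin⟩ := IsArtinian.set_has_minimal
    {I : Ideal (KAlg R A) | ∃ (M : Type u) (_ : AddCommGroup M) (_ : Module R M) (_ : Module A M)
      (_ : IsScalarTower R A M), IsLattice R M ∧ HasNoSummandIn A B M ∧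
      I = fracAnnihilator R A M}
    ⟨_, PUnit, inferInstance, inferInstance, inferInstance, inferInstance,
      IsLattice.of_smul_eq_zero fun _ _ _ _ => rfl, fun P Q _ _ => Subsingleton.elim _ _, rfl⟩
  refine ⟨M, inferInstance, inferInstance, inferInstance, inferInstance, hM, hMB, fun a ha => ?_⟩
  have haJ : a ∈ commonAnnihilator R A B := by
    intro N _ _ _ _ hN hNB n
    have hle : fracAnnihilator R A (M × N) ≤ fracAnnihilator R A M := fun x hx m =>
      (hx (m, 0)).map (LinearMap.fst A M N)
    have hle' : fracAnnihilator R A (M × N) ≤ fracAnnihilator R A N := fun x hx n =>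
      (hx (0, n)).map (LinearMap.snd A M N)
    have heq : fracAnnihilator R A (M × N) = fracAnnihilator R A M :=
      (hle.lt_or_eq).resolve_left (hmin _ ⟨M × N, _, _, _, inferInstance, hM.prod hN,
        HasNoSummandIn.prod hR hB hMB hNB, rfl⟩)
    have haM : toKAlg R A a ∈ fracAnnihilator R A M := fun m => by
      have := fracAct_toKAlg (R := R) a m
      rwa [ha m] at this
    rw [← heq] at haM
    exact (fracAct_toKAlg a n).unique hA hN (hle' haM n)
  rw [hJ] at haJ
  exact haJ

theorem KAlg.semiprime_subalgebra (hA : IsROrder R A) {A' : Subalgebra R (KAlg R A)}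
    (hA' : (toKAlg R A).range ≤ A') : HasNoNilpotentIdeals A' := by
  let φ : A →+* A' := (toKAlg R A).toRingHom.codRestrict A' fun a => hA' ⟨a, rfl⟩
  refine hA.semiprime.of_ringHom φ (fun a b hab => toKAlg_injective hA.isLattice
    (congrArg Subtype.val hab)) fun x hx => ?_
  obtain ⟨s, hs, a, ha⟩ := exists_smul_eq_toKAlg (x : KAlg R A)
  refine ⟨algebraMap R A' s, a, Subtype.ext ?_, fun h => hx (Subtype.ext ?_)⟩
  · rw [← Algebra.smul_def]; exact ha
  · rw [← Algebra.smul_def] at h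
    exact smul_cancel_KAlg hs ((congrArg Subtype.val h).trans (smul_zero s).symm)

/-- If some faithful lattice has no summand in the additive closure of `B`, then `A⁻(B)` is
contained in its endomorphism ring, and so is an order. -/
theorem isROrder_rejectionRing (hR : IsBaseRing R) (hA : IsROrder R A) {M : Type u}
    [AddCommGroup M] [Module R M] [Module A M] [IsScalarTower R A M] (hM : IsLattice R M)
    (hMB : HasNoSummandIn A B M) (hfaith : ∀ a : A, (∀ m : M, a • m = 0) → a = 0) :
    IsROrder R (rejectionRing R A B) := by
  have := hR.isNoetherianRing
  have := hM.finite
  choose f hf using fun (x : rejectionRing R A B) (m : M) => x.2 M hM hMB m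
  have huniq : ∀ (x : rejectionRing R A B) (m m' : M), FracAct (x : KAlg R A) m m' → f x m = m' :=
    fun x m m' h' => (hf x m).unique hA.isLattice hM h'
  let F : rejectionRing R A B →ₗ[R] (M →ₗ[R] M) :=
    { toFun := fun x =>
        { toFun := f x
          map_add' := fun m n => huniq _ _ _ ((hf x m).add_right hA.isLattice hM (hf x n))
          map_smul' := fun r m => huniq _ _ _ ((hf x m).map (smulEnd A M r)) }
      map_add' := fun x y => LinearMap.ext fun m => huniq _ _ _ ((hf x m).add_left (hf y m))
      map_smul' := fun r x => LinearMap.ext fun m => huniq _ _ _ (by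
        have := (hf x m).mul (fracAct_toKAlg (algebraMap R A r) (f x m))
        rwa [AlgHom.commutes, ← Algebra.smul_def, algebraMap_smul] at this) }
  have hF : Function.Injective F := by
    rw [injective_iff_map_eq_zero]
    intro x hx
    obtain ⟨s, hs, a, ha⟩ := exists_smul_eq_toKAlg (x : KAlg R A)
    have ha0 : a = 0 := hfaith a fun m => by
      have h0 : f x m = 0 := LinearMap.congr_fun hx m
      rw [← (hf x m).smul_eq hA.isLattice hM ha, h0, smul_zero]
    rw [ha0, map_zero] at ha
    exact Subtype.ext (smul_cancel_KAlg hs (ha.trans (smul_zero s).symm))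
  have : Module.Finite R (rejectionRing R A B) := Module.Finite.of_injective F hF
  refine ⟨IsLattice.of_smul_eq_zero fun s hs x hx => Subtype.ext (smul_cancel_KAlg hs ?_),
    KAlg.semiprime_subalgebra hA (range_toKAlg_le_rejectionRing B)⟩
  exact (congrArg Subtype.val hx).trans (smul_zero s).symm

end

section Overrings

variable {R A : Type u} [CommRing R] [Ring A] [Algebra R A]
variable {B : Type u} [AddCommGroup B] [Module A B]

/-- A ring between `A` and `KA`, as an `A`-module by restriction along the inclusion of `A`. -/
abbrev Subalgebra.moduleOfRangeLe {A' : Subalgebra R (KAlg R A)}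
    (hA' : (toKAlg R A).range ≤ A') : Module A A' :=
  Module.compHom A' ((toKAlg R A).toRingHom.codRestrict A' fun a => hA' ⟨a, rfl⟩)

theorem Subalgebra.isScalarTower_moduleOfRangeLe {A' : Subalgebra R (KAlg R A)}
    (hA' : (toKAlg R A).range ≤ A') :
    let := Subalgebra.moduleOfRangeLe hA'
    IsScalarTower R A A' := by
  let := Subalgebra.moduleOfRangeLe hA'
  refine ⟨fun r a x => Subtype.ext ?_⟩
  change toKAlg R A (r • a) * (x : KAlg R A) = r • (toKAlg R A a * (x : KAlg R A))
  rw [map_smul, smul_mul_assoc]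

theorem isModuleOver_self {A' : Subalgebra R (KAlg R A)} (hA' : (toKAlg R A).range ≤ A') :
    let := Subalgebra.moduleOfRangeLe hA'
    IsModuleOver R A A' A' :=
  let := Subalgebra.moduleOfRangeLe hA'
  ⟨inferInstance, fun a x m hx => Subtype.ext (by
    change (x : KAlg R A) * m = toKAlg R A a * m
    rw [hx])⟩

theorem IsModuleOver.of_retract {M N : Type u} [AddCommGroup M] [Module R M] [Module A M]
    [IsScalarTower R A M] [AddCommGroup N] [Module R N] [Module A N] [IsScalarTower R A N]
    (hA : IsLattice R A) (hM : IsLattice R M) (hN : IsLattice R N) {A' : Subalgebra R (KAlg R A)}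
    (h : IsModuleOver R A M A') (i : N →ₗ[A] M) (p : M →ₗ[A] N) (hpi : p ∘ₗ i = LinearMap.id) :
    IsModuleOver R A N A' :=
  (isModuleOver_iff_stabilizes hA hN).mpr fun x hx =>
    ((isModuleOver_iff_stabilizes hA hM).mp h x hx).of_retract i p hpi

theorem LatticesDecompose.le_rejectionRing (hR : IsBaseRing R) (hA : IsLattice R A)
    {A' : Subalgebra R (KAlg R A)} (h : LatticesDecompose R A B A') :
    A' ≤ rejectionRing R A B := by
  have := hR.isNoetherianRing
  intro x hx M _ _ _ _ hM hMB m
  obtain ⟨P, Q, hPQ, hP, hQ⟩ := h M hM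
  have hP0 := hMB P Q hPQ hP
  obtain rfl : Q = ⊤ := by rw [hP0] at hPQ; exact eq_top_of_bot_isCompl hPQ
  obtain ⟨m', hm'⟩ := (isModuleOver_iff_stabilizes hA (hM.submodule _)).mp hQ x hx
    ⟨m, Submodule.mem_top⟩
  exact ⟨m', hm'.map (Submodule.subtype ⊤)⟩

theorem latticesDecompose_rejectionRing (hR : IsBaseRing R) (hA : IsLattice R A) :
    LatticesDecompose R A B (rejectionRing R A B) := by
  have := hR.isNoetherianRing
  intro M _ _ _ _ hM
  have := hM.isNoetherian (A := A)
  obtain ⟨P, Q, hPQ, hP, hQ⟩ := exists_isCompl_hasNoSummandIn (A := A) (M := M) (B := B)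
  exact ⟨P, Q, hPQ, hP, (isModuleOver_iff_stabilizes hA (hM.submodule Q)).mpr fun x hx =>
    hx Q (hM.submodule Q) hQ⟩

theorem rejectsSummands_rejectionRing [Module R B] [IsScalarTower R A B]
    (hR : IsBaseRing R) (hA : IsLattice R A)
    (hB : IsBijectiveLattice R A B) : RejectsSummands R A B (rejectionRing R A B) :=
  fun _ _ _ _ _ hM hmod hMB => subsingleton_of_rejectionRing_stabilizes hR hA hB hMB
    ((isModuleOver_iff_stabilizes hA hM).mp hmod)

theorem RejectsSummands.hasNoSummandIn (hR : IsBaseRing R) (hA : IsLattice R A)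
    {M : Type u} [AddCommGroup M] [Module R M] [Module A M]
    [IsScalarTower R A M] (hM : IsLattice R M) {A' : Subalgebra R (KAlg R A)}
    (h : RejectsSummands R A B A') (hmod : IsModuleOver R A M A') : HasNoSummandIn A B M := by
  have := hR.isNoetherianRing
  intro P Q hPQ hP
  obtain ⟨p, hp⟩ := Submodule.exists_retraction hPQ
  have := h P (hM.submodule P) (hmod.of_retract hA hM (hM.submodule P) _ _ hp) hP
  exact Submodule.eq_bot_of_subsingleton

/-- An overring that rejects `B` is, as a lattice over itself, preserved by `A⁻(B)`, and it contains
`1`. -/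
theorem RejectsSummands.rejectionRing_le (hR : IsBaseRing R) (hA : IsLattice R A)
    {A' : Subalgebra R (KAlg R A)} (hA' : IsOverring R A A') (h : RejectsSummands R A B A') :
    rejectionRing R A B ≤ A' := by
  let := Subalgebra.moduleOfRangeLe hA'.lt.le
  have := Subalgebra.isScalarTower_moduleOfRangeLe hA'.lt.le
  have hlat := hA'.isROrder.isLattice
  have hfree := h.hasNoSummandIn hR hA hlat (isModuleOver_self hA'.lt.le)
  intro x hx
  obtain ⟨y, s, hs, a, ha, hy⟩ := hx A' hlat hfree 1
  have hxy : (y : KAlg R A) = x := by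
    refine smul_cancel_KAlg hs ?_
    rw [ha]
    refine (congrArg Subtype.val hy).trans ?_
    change toKAlg R A a * 1 = _
    rw [mul_one]
  exact hxy ▸ y.2

/-- For indecomposable `B`, an overring over which all lattices decompose rejects `B`: otherwise
`B`, hence every lattice, and in particular `A`, would be a module over the overring. -/
theorem LatticesDecompose.rejectsSummands [Module R B] [IsScalarTower R A B]
    (hR : IsBaseRing R) (hA : IsLattice R A)
    (hB : IsLattice R B) (hind : IsIndecomposableModule A B)
    {A' : Subalgebra R (KAlg R A)} (hA' : IsOverring R A A') (h : LatticesDecompose R A B A') :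
    RejectsSummands R A B A' := by
  have := hR.isNoetherianRing
  intro N _ _ _ _ hN hmod hNB
  by_contra hne
  rw [not_subsingleton_iff_nontrivial] at hne
  have := hN.isNoetherian (A := A)
  have hBmod : ∀ x ∈ A', Stabilizes x B := by
    obtain ⟨N', Q, hN'Q, hind'⟩ := exists_indecomposable_retract (A := A) (M := N)
    obtain ⟨p, hp⟩ := Submodule.exists_retraction hN'Q
    obtain ⟨r, i, q, hqi⟩ := hNB.of_retract _ _ hp
    obtain ⟨j, q, hqj⟩ := hind'.retract_of_retract_pi hR (hN.submodule N') i q hqi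
    have hqj' : ∀ n, q (j n) = n := LinearMap.congr_fun hqj
    have := hind'.1
    rcases hind.2 _ _ (LinearMap.isCompl_range_ker_of_comp_eq_id hqj) with h0 | h0
    · obtain ⟨n, hn⟩ := exists_ne (0 : N')
      rw [LinearMap.range_eq_bot] at h0
      exact absurd (by rw [← hqj' n, h0, LinearMap.zero_apply, map_zero]) hn
    · have hjq : j ∘ₗ q = LinearMap.id :=
        LinearMap.ext fun b => LinearMap.ker_eq_bot.mp h0 (hqj' (q b))
      exact fun x hx => (((isModuleOver_iff_stabilizes hA hN).mp hmod x hx).of_retract _ _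
        hp).of_retract q j hjq
  obtain ⟨P, Q, hPQ, ⟨r, i, p, hpi⟩, hQ⟩ := h A hA
  refine hA'.lt.not_ge fun x hx => ?_
  have hP : Stabilizes x P := ((hBmod x hx).pi hA hB r).of_retract i p hpi
  have hQ := (isModuleOver_iff_stabilizes hA (hA.submodule Q)).mp hQ x hx
  obtain ⟨e, he, f, hf, hef⟩ := Submodule.mem_sup.mp
    (hPQ.sup_eq_top ▸ Submodule.mem_top : (1 : A) ∈ P ⊔ Q)
  obtain ⟨e', he'⟩ := hP ⟨e, he⟩
  obtain ⟨f', hf'⟩ := hQ ⟨f, hf⟩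
  have h1 : FracAct x (e + f) ((e' : A) + f') :=
    (he'.map P.subtype).add_right hA hA (hf'.map Q.subtype)
  rw [hef] at h1
  obtain ⟨s, hs, a, ha, hy⟩ := h1
  refine ⟨(e' : A) + f', smul_cancel_KAlg hs ?_⟩
  change s • toKAlg R A _ = _
  rw [ha, ← map_smul, hy, smul_eq_mul, mul_one]

end Overrings

theorem lemma3p2 (R A B : Type u) [CommRing R] [Ring A] [Algebra R A]
    [AddCommGroup B] [Module R B] [Module A B] [IsScalarTower R A B]
    (hR : IsBaseRing R) (hA : IsROrder R A) (hconn : IsConnectedRing A)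
    (hB : IsBijectiveLattice R A B) (hB0 : Nontrivial B) :
    Xor
      (IsHereditaryRing A ∧ IsSummandOfMultiple A A B ∧
        ∀ (M : Type u) [AddCommGroup M] [Module R M] [Module A M] [IsScalarTower R A M],
          IsLattice R M → IsSummandOfMultiple A M B)
      (∃ A' : Subalgebra R (KAlg R A),
        (IsOverring R A A' ∧ LatticesDecompose R A B A' ∧ RejectsSummands R A B A') ∧
        (∀ A'' : Subalgebra R (KAlg R A), IsOverring R A A'' →
          LatticesDecompose R A B A'' → RejectsSummands R A B A'' → A'' = A') ∧
        (∀ A'' : Subalgebra R (KAlg R A), IsOverring R A A'' →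
          LatticesDecompose R A B A'' → A'' ≤ A') ∧
        (IsIndecomposableModule A B →
          (∀ A'' : Subalgebra R (KAlg R A), IsOverring R A A'' →
            LatticesDecompose R A B A'' → A'' = A') ∧
          (∀ A'' : Subalgebra R (KAlg R A), IsOverring R A A'' → A'' ≤ A' → A'' = A'))) := by
  have := hR.isNoetherianRing
  have hAl := hA.isLattice
  by_cases hJ : commonAnnihilator R A B = ⊥
  · obtain ⟨M, _, _, _, _, hM, hMB, hfaith⟩ :=
      exists_faithful_of_commonAnnihilator_eq_bot hR hAl hB.isLattice hJ
    have hdec : LatticesDecompose R A B (rejectionRing R A B) :=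
      latticesDecompose_rejectionRing hR hAl
    have hrej := rejectsSummands_rejectionRing hR hAl hB
    have huniq : ∀ A'' : Subalgebra R (KAlg R A), IsOverring R A A'' →
        LatticesDecompose R A B A'' → RejectsSummands R A B A'' → A'' = rejectionRing R A B :=
      fun A'' hA'' hd hr => le_antisymm (hd.le_rejectionRing hR hAl)
        (hr.rejectionRing_le hR hAl hA'')
    have huniq' : IsIndecomposableModule A B → ∀ A'' : Subalgebra R (KAlg R A),
        IsOverring R A A'' → LatticesDecompose R A B A'' → A'' = rejectionRing R A B :=
      fun hind A'' hA'' hd => huniq A'' hA'' hd (hd.rejectsSummands hR hAl hB.isLattice hind hA'')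
    have hover : IsOverring R A (rejectionRing R A B) := by
      refine ⟨lt_of_le_of_ne (range_toKAlg_le_rejectionRing B) fun h => ?_,
        isROrder_rejectionRing hR hA hM hMB hfaith⟩
      -- `B` is stable under `A`, but not under `A⁻(B)`
      refine not_nontrivial_iff_subsingleton.mpr
        (subsingleton_of_rejectionRing_stabilizes hR hAl hB (IsSummandOfMultiple.refl B) ?_) hB0
      rw [← h]
      rintro _ ⟨a, rfl⟩ b
      exact ⟨a • b, fracAct_toKAlg a b⟩
    refine Or.inr ⟨⟨rejectionRing R A B, ⟨hover, hdec, hrej⟩, huniq,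
      fun A'' _ hd => hd.le_rejectionRing hR hAl, fun hind => ⟨huniq' hind, ?_⟩⟩, ?_⟩
    · intro A'' hA'' hle
      refine huniq' hind A'' hA'' fun N _ _ _ _ hN => ?_
      obtain ⟨P, Q, hPQ, hP, hQ⟩ := hdec N hN
      have hQ' := (isModuleOver_iff_stabilizes hAl (hN.submodule Q)).mp hQ
      exact ⟨P, Q, hPQ, hP, (isModuleOver_iff_stabilizes hAl (hN.submodule Q)).mpr
        fun x hx => hQ' x (hle hx)⟩
    · rintro ⟨-, -, hall⟩
      -- the lattice `M` without summands would itself be a summand of a multiple of `B`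
      have := hMB.subsingleton_of_retract (hall M hM) LinearMap.id LinearMap.id rfl
      have h1 : (1 : A) = 0 := hfaith 1 fun m => Subsingleton.elim _ _
      have := hconn.1
      exact one_ne_zero h1
  · have hall : ∀ (M : Type u) [AddCommGroup M] [Module R M] [Module A M] [IsScalarTower R A M],
        IsLattice R M → IsSummandOfMultiple A M B := by
      intro M _ _ _ _ hM
      have := hM.isNoetherian (A := A)
      obtain ⟨P, Q, hPQ, hP, hQ⟩ := exists_isCompl_hasNoSummandIn (A := A) (M := M) (B := B)
      have := subsingleton_of_commonAnnihilator_ne_bot hR hA hconn hB hJ Q (hM.submodule Q) hQ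
      exact hP.of_isCompl_bot hPQ Submodule.eq_bot_of_subsingleton
    refine Or.inl ⟨⟨fun I => ?_, hall A hAl, hall⟩, ?_⟩
    · have := hB.projective
      exact (hall I (hAl.submodule I)).projective
    · rintro ⟨A', ⟨hA', -, hrej⟩, -⟩
      -- the lattice `A'` over itself would be a summand of a multiple of `B`
      let := Subalgebra.moduleOfRangeLe hA'.lt.le
      have := Subalgebra.isScalarTower_moduleOfRangeLe hA'.lt.le
      have hmod : IsModuleOver R A A' A' := isModuleOver_self hA'.lt.le
      have hsub := hrej A' hA'.isROrder.isLattice hmod (hall A' hA'.isROrder.isLattice)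
      have h1 : (1 : KAlg R A) = 0 := congrArg Subtype.val (Subsingleton.elim (1 : A') 0)
      have := hconn.1
      exact one_ne_zero (toKAlg_injective hAl (a₁ := 1) (a₂ := 0) (by rw [map_one, map_zero, h1]))
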